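/- **Spaces.** A topological space is *locally connected* if each point has a basis of connected neighbourhoods. In a locally connected space $X$, an open set $U$ is *Z-dense* if $U\cap C$ is non-empty and connected for every non-empty connected open $C\subseteq X$; a subset $I\subseteq X$ is *negligible* if $X\setminus I$ is Z-dense. A *negligible subset element* of a space is a pair $(U,I)$ with $U$ open, locally connected as a subspace, and $I\subseteq U$ negligible in $U$. A continuous map $f:X\to Y$ of locally connected spaces is *diffuse* if $(f^{-1}U,f^{-1}I)$ is a negligible subset element of $X$ for every negligible subset element $(U,I)$ of $Y$. Let $\mathbf{Gen}$ be the category of locally connected spaces and diffuse continuous maps, and $\mathbf{HGen}$, $\mathbf{HGen}^+$ its full subcategories of Hausdorff, respectively locally Hausdorff (covered by Hausdorff open subsets), spaces. **Topologies.** A *topology* on a category $\mathcal C$ is a pair $(Sub,Cov)$, where $Sub$ is a class of morphisms (*formal subsets*) that contains the isomorphisms, is closed under composition, and whose members have pullbacks along all morphisms, these being again in $Sub$; and $Cov$ is a class of non-empty cones of formal subsets (*covers*; a cone into $X$ is a class of morphisms with codomain $X$) such that: a cone of formal subsets containing a cover is a cover; $\{b\}$ is a cover for each isomorphism $b$; composing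 the members of a cover with the members of covers of their domains gives a cover; pullbacks of covers along arbitrary morphisms are covers; and for $f\in Sub$ each projection of $f\times_{\mathrm{cod} f}f$ is, by itself, a cover. The topology is *small* if the formal subsets of each object form a set up to isomorphism over it, and *flush* if a cone of formal subsets into $X$ is a cover whenever each member of some cover of $X$ factors through one of its members. A *$J$-graph* $A$ ($J$ a set) consists of objects $A[j]$, $A[j,k]$ and morphisms $\rho_1:A[j,k]\to A[j]$, $\rho_2:A[j,k]\to A[k]$ for $j,k\in J$. It is a *canopy of* an indexed cone $\theta=(\theta_j:A[j]\to X)_{j\in J}$ if $(A[j,k];\rho_1,\rho_2)$ is a fibered product $\theta_j\times_X\theta_k$ for all $j,k$. It is a *canopy* if $J\neq\emptyset$, all $\rho_1,\rho_2$ are formal subsets, each pair $(\rho_1,\rho_2)$ is jointly monomorphic, and it is reflexive (for each $j$ there is $\delta:A[j]\to A[j,j]$ with $\rho_1\delta=1=\rho_2\delta$), symmetric (for all $j,k$ there is $\sigma:A[j,k]\to A[k,j]$ with $\rho_1\sigma=\rho_2$, $\rho_2\sigma=\rho_1$) and transitive (for all $i,j,k$ and each fibered product $P$ of $\rho_2:A[i,j]\to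 A[j]$ and $\rho_1:A[j,k]\to A[j]$, with projections $p,q$, there is $\omega:P\to A[i,k]$ with $\rho_1\omega=\rho_1p$, $\rho_2\omega=\rho_2q$). An *affinization* of $A$ is a cover $\theta$ by formal subsets $\theta_j:A[j]\to X$ of which $A$ is a canopy. The topology is *intrinsic* if for each indexed cover $\theta$ of an object $X$, $X$ is, via $\theta$, the colimit of any canopy of $\theta$. Let $Cvm$ be the class of formal subsets $b$ for which $\{b\}$ is a cover. The topology satisfies *CLCS* if (i) $Cvm$ contains the isomorphisms, is closed under composition, its members have pullbacks along all morphisms and these are again in $Cvm$, and $b:B\to A$ is in $Cvm$ whenever its pullback along each member of some cover of $A$ is in $Cvm$; and (ii) $b:B\to A$ is a formal subset whenever $B$ has a cover $S$ such that for each $s\in S$, $b\circ s$ is a formal subset and the pullback of $b$ along $b\circ s$ is an isomorphism. The category is *closed under $Cvm$* if, whenever $q:Q\to A$ is a morphism of canopies indexed by the same set, all of whose components are in $Cvm$ and whose commutative squares with $\rho_1$ and with $\rho_2$ are cartesian, and $A$ has an affinization, then $Q$ has one. A *local structure* is a category with a small, flush, intrinsic topology that satisfies CLCS and is closed under $Cvm$.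 A *global structure* is a local structure in which every canopy has an affinization. A functor is *continuous* if it preserves formal subsets, covers, and pullbacks along formal subsets. A *globalization* of a local structure $\mathcal C$ is a fully faithful continuous functor $F:\mathcal C\to\mathcal D$ to a global structure such that a morphism (cone) of $\mathcal C$ is a formal subset (cover) if and only if its image is one; every object of $\mathcal D$ has a set-indexed cover by objects $F(U)$, $U\in\mathcal C$; and for every global structure $\mathcal E$, restriction along $F$ is an equivalence from the category of continuous functors $\mathcal D\to\mathcal E$ to that of continuous functors $\mathcal C\to\mathcal E$ (morphisms: natural transformations). **Theorem.** Give $\mathbf{Gen}$, $\mathbf{HGen}$ and $\mathbf{HGen}^+$ the *pseudogeometric topology*: the formal subsets are the open embeddings, and the covers are the non-empty, jointly surjective cones of open embeddings. Then $\mathbf{Gen}$ and $\mathbf{HGen}^+$ are global structures and $\mathbf{HGen}$ is a local structure. Moreover, the inclusion $\mathbf{HGen}\to\mathbf{HGen}^+$ is a globalization. -/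

import Mathlib

open CategoryTheory CategoryTheory.Limits Topology

universe u v w v₁ w₁ v₂ w₂

/-! ### Point-set notions -/

/-- An open subset `U` of `X` is *Z-dense* if it meets every non-empty connected open subset
of `X` in a non-empty connected set (`IsConnected` includes non-emptiness). -/
def IsZDense {X : Type u} [TopologicalSpace X] (U : Set X) : Prop :=
  IsOpen U ∧ ∀ C : Set X, IsOpen C → IsConnected C → IsConnected (U ∩ C)

/-- A subset is *negligible* if its complement is Z-dense. -/
def IsNegligible {X : Type u} [TopologicalSpace X] (I : Set X) : Prop :=
  IsZDense Iᶜ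

/-- A *negligible subset element* `(U, I)` of `X`: `U` is an open subset of `X` which is locally
connected in the subset topology, and `I ⊆ U` is a negligible subset of `U`. -/
structure IsNegligibleElement {X : Type u} [TopologicalSpace X] (U I : Set X) : Prop where
  isOpen : IsOpen U
  subset : I ⊆ U
  locallyConnected : LocallyConnectedSpace U
  negligible : IsNegligible (Subtype.val ⁻¹' I : Set U)

/-- A *diffuse* continuous function: it pulls back negligible subset elements to
negligible subset elements. -/
structure IsDiffuse {X Y : Type u} [TopologicalSpace X] [TopologicalSpace Y] (f : X → Y) :
    Prop where
  continuous : Continuous f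
  pullback : ∀ U I : Set Y, IsNegligibleElement U I → IsNegligibleElement (f ⁻¹' U) (f ⁻¹' I)

theorem IsDiffuse.id {X : Type u} [TopologicalSpace X] : IsDiffuse (fun x : X => x) :=
  ⟨continuous_id, fun _ _ h => h⟩

theorem IsDiffuse.comp {X Y Z : Type u} [TopologicalSpace X] [TopologicalSpace Y]
    [TopologicalSpace Z] {g : Y → Z} {f : X → Y} (hg : IsDiffuse g) (hf : IsDiffuse f) :
    IsDiffuse (fun x => g (f x)) :=
  ⟨hg.continuous.comp hf.continuous, fun U I h => hf.pullback _ _ (hg.pullback U I h)⟩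

/-- A space is *locally Hausdorff* if it has a cover by open subsets, each of which is Hausdorff
in the subset topology. -/
def IsLocallyHausdorff (X : Type u) [TopologicalSpace X] : Prop :=
  ∃ 𝒱 : Set (Set X), (∀ V ∈ 𝒱, IsOpen V ∧ T2Space V) ∧ ⋃₀ 𝒱 = Set.univ

theorem IsLocallyHausdorff.of_t2Space (X : Type u) [TopologicalSpace X] [T2Space X] :
    IsLocallyHausdorff X :=
  ⟨{Set.univ}, by
    intro V hV
    rw [Set.mem_singleton_iff] at hV
    subst hV
    exact ⟨isOpen_univ, inferInstance⟩, by simp⟩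

/-! ### The categories `Gen`, `HGen`, `HGen⁺` -/

/-- Objects of `Gen`: locally connected topological spaces. -/
structure Gen : Type (u + 1) where
  carrier : Type u
  [top : TopologicalSpace carrier]
  [locallyConnected : LocallyConnectedSpace carrier]

attribute [instance] Gen.top Gen.locallyConnected

/-- Morphisms of `Gen`: diffuse continuous functions. -/
@[ext]
structure Gen.Hom (X Y : Gen.{u}) : Type u where
  toFun : X.carrier → Y.carrier
  diffuse : IsDiffuse toFun

instance Gen.category : Category.{u} Gen.{u} where
  Hom X Y := Gen.Hom X Y
  id _ := ⟨fun x => x, IsDiffuse.id⟩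
  comp f g := ⟨fun x => g.toFun (f.toFun x), g.diffuse.comp f.diffuse⟩

/-- The inclusion of the subcategory `Gen` in the category of topological spaces. -/
def Gen.toTop : Gen.{u} ⥤ TopCat.{u} where
  obj X := TopCat.of X.carrier
  map f := TopCat.ofHom ⟨f.toFun, f.diffuse.continuous⟩

/-- The property of being Hausdorff. -/
def Gen.hausdorff : ObjectProperty Gen.{u} := fun X => T2Space X.carrier

/-- The property of being locally Hausdorff. -/
def Gen.locallyHausdorff : ObjectProperty Gen.{u} := fun X => IsLocallyHausdorff X.carrier

theorem Gen.hausdorff_le : Gen.hausdorff.{u} ≤ Gen.locallyHausdorff := fun X hX =>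
  haveI : T2Space X.carrier := hX
  IsLocallyHausdorff.of_t2Space X.carrier

/-- The full subcategory of Hausdorff objects of `Gen`. -/
abbrev HGen : Type (u + 1) := Gen.hausdorff.{u}.FullSubcategory

/-- The full subcategory of locally Hausdorff objects of `Gen`. -/
abbrev HGenPlus : Type (u + 1) := Gen.locallyHausdorff.{u}.FullSubcategory

/-- The inclusion `HGen ⟶ HGen⁺`. -/
abbrev HGen.inclusion : HGen.{u} ⥤ HGenPlus.{u} :=
  ObjectProperty.ιOfLE Gen.hausdorff_le

/-! ### Categorical topologies

A *cone* into an object `X` is a class of morphisms with codomain `X`, i.e. a `Presieve X`.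
An *indexed cone* is indexed by a set, i.e. by a type `J : Type u`, where `u` is the fixed universe
whose types play the role of sets. -/

/-- A class of morphisms *contains isomorphisms, is closed under composition, consists of
pullback bases and is stable under pullback*. -/
structure IsFormalSubsetUniverse {C : Type w} [Category.{v} C] (W : MorphismProperty C) :
    Prop where
  of_isIso : ∀ ⦃X Y : C⦄ (f : X ⟶ Y), IsIso f → W f
  comp : ∀ ⦃X Y Z : C⦄ (f : X ⟶ Y) (g : Y ⟶ Z), W f → W g → W (f ≫ g)
  pullbackBase : ∀ ⦃U X Y : C⦄ (b : U ⟶ Y) (f : X ⟶ Y), W b → HasPullback f b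
  pullback_mem : ∀ ⦃P U X Y : C⦄ (p : P ⟶ X) (q : P ⟶ U) (f : X ⟶ Y) (b : U ⟶ Y),
    IsPullback p q f b → W b → W p

/-- The data `(Sub, Cov)` of a categorical topology: a class of formal subsets and a class of
covering cones. -/
structure CatTopology (C : Type w) [Category.{v} C] where
  Sub : MorphismProperty C
  Cov : ∀ X : C, Set (Presieve X)

namespace CatTopology

variable {C : Type w} [Category.{v} C]

/-- A cone all of whose members are formal subsets. -/
def IsSubCone (T : CatTopology C) {X : C} (S : Presieve X) : Prop :=
  ∀ ⦃Y : C⦄ (s : Y ⟶ X), S s → T.Sub s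

/-- The axioms on `(Sub, Cov)`. -/
structure IsTopology (T : CatTopology C) : Prop where
  sub : IsFormalSubsetUniverse T.Sub
  cov_isSubCone : ∀ ⦃X : C⦄ (S : Presieve X), S ∈ T.Cov X → T.IsSubCone S
  cov_nonempty : ∀ ⦃X : C⦄ (S : Presieve X), S ∈ T.Cov X → ∃ (Y : C) (s : Y ⟶ X), S s
  cov_mono : ∀ ⦃X : C⦄ (S R : Presieve X), S ∈ T.Cov X → S ≤ R → T.IsSubCone R → R ∈ T.Cov X
  cov_iso : ∀ ⦃X Y : C⦄ (b : X ⟶ Y), IsIso b → Presieve.singleton b ∈ T.Cov Y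
  cov_bind : ∀ ⦃X : C⦄ (S : Presieve X) (θ : ∀ ⦃Y : C⦄ ⦃s : Y ⟶ X⦄, S s → Presieve Y),
    S ∈ T.Cov X → (∀ ⦃Y : C⦄ ⦃s : Y ⟶ X⦄ (hs : S s), θ hs ∈ T.Cov Y) →
      Presieve.bind S θ ∈ T.Cov X
  /-- If `R` consists of pullbacks along `f` of the members of a cover `S`, at least one for each
  member of `S`, then `R` covers. -/
  cov_pullback : ∀ ⦃X Y : C⦄ (f : X ⟶ Y) (S : Presieve Y) (R : Presieve X), S ∈ T.Cov Y →
    (∀ ⦃U : C⦄ (s : U ⟶ Y), S s → ∃ (P : C) (p : P ⟶ X) (q : P ⟶ U), R p ∧ IsPullback p q f s) →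
    (∀ ⦃P : C⦄ (p : P ⟶ X), R p →
      ∃ (U : C) (s : U ⟶ Y) (q : P ⟶ U), S s ∧ IsPullback p q f s) →
    R ∈ T.Cov X
  cov_fst : ∀ ⦃P X Y : C⦄ (f : X ⟶ Y) (π₁ π₂ : P ⟶ X), T.Sub f → IsPullback π₁ π₂ f f →
    Presieve.singleton π₁ ∈ T.Cov X
  cov_snd : ∀ ⦃P X Y : C⦄ (f : X ⟶ Y) (π₁ π₂ : P ⟶ X), T.Sub f → IsPullback π₁ π₂ f f →
    Presieve.singleton π₂ ∈ T.Cov X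

/-- *Smallness*: for each `X` there is a set of formal subsets of `X` such that every formal
subset of `X` is isomorphic over `X` to a member of it. -/
def IsSmall (T : CatTopology C) : Prop :=
  ∀ X : C, ∃ (J : Type u) (U : J → C) (θ : ∀ j, U j ⟶ X), (∀ j, T.Sub (θ j)) ∧
    ∀ ⦃Y : C⦄ (s : Y ⟶ X), T.Sub s → ∃ (j : J) (e : Y ≅ U j), e.hom ≫ θ j = s

/-- *Flushness*: if each member of a cover `R` factors through some member of a cone `S` of
formal subsets, then `S` covers. -/
def IsFlush (T : CatTopology C) : Prop :=
  ∀ ⦃X : C⦄ (R S : Presieve X), R ∈ T.Cov X → T.IsSubCone S →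
    (∀ ⦃Y : C⦄ (r : Y ⟶ X), R r → ∃ (Z : C) (s : Z ⟶ X) (g : Y ⟶ Z), S s ∧ g ≫ s = r) →
    S ∈ T.Cov X

end CatTopology

/-- A graph of type `Int(J)`: objects indexed by `J ⊔ J²`, with
`ρ₁ : A[j,k] ⟶ A[j]` and `ρ₂ : A[j,k] ⟶ A[k]`. -/
structure CanopyGraph (C : Type w) [Category.{v} C] (J : Type u) where
  obj : J → C
  obj₂ : J → J → C
  ρ₁ : ∀ j k, obj₂ j k ⟶ obj j
  ρ₂ : ∀ j k, obj₂ j k ⟶ obj k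

namespace CanopyGraph

variable {C : Type w} [Category.{v} C] {J : Type u}

/-- `A` is a canopy of the indexed cone `θ`: `A[j,k]` is a fibered product of
`θ j` and `θ k`. -/
def IsCanopyOf (A : CanopyGraph C J) {X : C} (θ : ∀ j, A.obj j ⟶ X) : Prop :=
  ∀ j k, IsPullback (A.ρ₁ j k) (A.ρ₂ j k) (θ j) (θ k)

/-- `X`, with the morphisms `θ j`, is a colimit of the graph `A`. -/
def IsColimitCone (A : CanopyGraph C J) {X : C} (θ : ∀ j, A.obj j ⟶ X) : Prop :=
  (∀ j k, A.ρ₁ j k ≫ θ j = A.ρ₂ j k ≫ θ k) ∧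
  ∀ ⦃Y : C⦄ (f : ∀ j, A.obj j ⟶ Y), (∀ j k, A.ρ₁ j k ≫ f j = A.ρ₂ j k ≫ f k) →
    ∃! g : X ⟶ Y, ∀ j, θ j ≫ g = f j

/-- `A` is an (abstract) *canopy* for the topology `T`: an equivalence relation on the
family `A[j]` by formal subsets. -/
structure IsCanopy (T : CatTopology C) (A : CanopyGraph C J) : Prop where
  nonempty : Nonempty J
  sub₁ : ∀ j k, T.Sub (A.ρ₁ j k)
  sub₂ : ∀ j k, T.Sub (A.ρ₂ j k)
  jointlyMono : ∀ j k ⦃D : C⦄ (f g : D ⟶ A.obj₂ j k),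
    f ≫ A.ρ₁ j k = g ≫ A.ρ₁ j k → f ≫ A.ρ₂ j k = g ≫ A.ρ₂ j k → f = g
  refl : ∀ j, ∃ δ : A.obj j ⟶ A.obj₂ j j, δ ≫ A.ρ₁ j j = 𝟙 _ ∧ δ ≫ A.ρ₂ j j = 𝟙 _
  symm : ∀ j k, ∃ σ : A.obj₂ j k ⟶ A.obj₂ k j,
    σ ≫ A.ρ₁ k j = A.ρ₂ j k ∧ σ ≫ A.ρ₂ k j = A.ρ₁ j k
  trans : ∀ i j k ⦃P : C⦄ (p : P ⟶ A.obj₂ i j) (q : P ⟶ A.obj₂ j k),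
    IsPullback p q (A.ρ₂ i j) (A.ρ₁ j k) →
      ∃ ω : P ⟶ A.obj₂ i k, ω ≫ A.ρ₁ i k = p ≫ A.ρ₁ i j ∧ ω ≫ A.ρ₂ i k = q ≫ A.ρ₂ j k

/-- An *affinization* of `A`: a cover `θ` by formal subsets of which `A` is a canopy. -/
structure IsAffinization (T : CatTopology C) (A : CanopyGraph C J) {X : C}
    (θ : ∀ j, A.obj j ⟶ X) : Prop where
  sub : ∀ j, T.Sub (θ j)
  cov : Presieve.ofArrows A.obj θ ∈ T.Cov X
  canopyOf : A.IsCanopyOf θ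

/-- `A` has an affinization. -/
def HasAffinization (T : CatTopology C) (A : CanopyGraph C J) : Prop :=
  ∃ (X : C) (θ : ∀ j, A.obj j ⟶ X), A.IsAffinization T θ

/-- A *pullback system* `q : Q ⟶ A` of `W`-morphisms. -/
structure IsPullbackSystem (W : MorphismProperty C) (Q A : CanopyGraph C J)
    (q : ∀ j, Q.obj j ⟶ A.obj j) (q₂ : ∀ j k, Q.obj₂ j k ⟶ A.obj₂ j k) : Prop where
  mem : ∀ j, W (q j)
  mem₂ : ∀ j k, W (q₂ j k)
  isPullback₁ : ∀ j k, IsPullback (Q.ρ₁ j k) (q₂ j k) (q j) (A.ρ₁ j k)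
  isPullback₂ : ∀ j k, IsPullback (Q.ρ₂ j k) (q₂ j k) (q k) (A.ρ₂ j k)

end CanopyGraph

namespace CatTopology

variable {C : Type w} [Category.{v} C]

/-- The topology is *intrinsic*: for each indexed cover `θ` of `X`, the canonical cone into `X`
of any canopy of `θ` is a colimit.  (Pullbacks of covers are covers.) -/
def IsIntrinsic (T : CatTopology C) : Prop :=
  ∀ ⦃J : Type u⦄ ⦃X : C⦄ (A : CanopyGraph C J) (θ : ∀ j, A.obj j ⟶ X),
    Presieve.ofArrows A.obj θ ∈ T.Cov X → A.IsCanopyOf θ → A.IsColimitCone θ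

/-- *Covering morphisms*: formal subsets `b` for which `{b}` covers. -/
def Cvm (T : CatTopology C) : MorphismProperty C := fun _ Y b =>
  T.Sub b ∧ Presieve.singleton b ∈ T.Cov Y

/-- A *universe of layered morphisms*: like a universe of formal subsets, and moreover membership
is local on the codomain. -/
structure IsLayered (T : CatTopology C) (W : MorphismProperty C) : Prop where
  formal : IsFormalSubsetUniverse W
  local_target : ∀ ⦃B A : C⦄ (b : B ⟶ A) (S : Presieve A), S ∈ T.Cov A →
    (∀ ⦃U : C⦄ (s : U ⟶ A), S s → ∃ (P : C) (p : P ⟶ B) (q : P ⟶ U),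
      IsPullback p q b s ∧ W q) → W b

/-- The *CLCS criterion*.  In the second part, the pullback of `b` along the formal subset
`b ∘ s` is required to be an isomorphism. -/
structure IsCLCS (T : CatTopology C) : Prop where
  layered : T.IsLayered T.Cvm
  sub_of_local : ∀ ⦃B A : C⦄ (b : B ⟶ A) (S : Presieve B), S ∈ T.Cov B →
    (∀ ⦃U : C⦄ (s : U ⟶ B), S s → T.Sub (s ≫ b) ∧
      ∃ (P : C) (p : P ⟶ B) (q : P ⟶ U), IsPullback p q b (s ≫ b) ∧ IsIso q) → T.Sub b

/-- The category is *closed under* `W`: if a canopy `A` has an affinization then so does each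
canopy `Q` with a pullback system `Q ⟶ A` of `W`-morphisms. -/
def IsClosedUnder (T : CatTopology C) (W : MorphismProperty C) : Prop :=
  ∀ ⦃J : Type u⦄ (Q A : CanopyGraph C J), Q.IsCanopy T → A.IsCanopy T →
    ∀ (q : ∀ j, Q.obj j ⟶ A.obj j) (q₂ : ∀ j k, Q.obj₂ j k ⟶ A.obj₂ j k),
      CanopyGraph.IsPullbackSystem W Q A q q₂ → A.HasAffinization T → Q.HasAffinization T

/-- A *local structure*. -/
structure IsLocalStructure (T : CatTopology C) : Prop where
  topology : T.IsTopology
  small : IsSmall.{u} T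
  flush : T.IsFlush
  intrinsic : IsIntrinsic.{u} T
  clcs : T.IsCLCS
  closed_cvm : IsClosedUnder.{u} T T.Cvm

/-- A *global structure*: a local structure in which every canopy has an affinization. -/
structure IsGlobalStructure (T : CatTopology C) : Prop where
  localStructure : IsLocalStructure.{u} T
  closed : ∀ ⦃J : Type u⦄ (A : CanopyGraph C J), A.IsCanopy T → A.HasAffinization T

end CatTopology

/-- A *continuous functor*: it preserves formal subsets, covers, and pullbacks along formal
subsets. -/
structure IsContinuousFunctor {C : Type w₁} [Category.{v₁} C] {D : Type w₂} [Category.{v₂} D]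
    (T : CatTopology C) (K : CatTopology D) (F : C ⥤ D) : Prop where
  map_sub : ∀ ⦃X Y : C⦄ (f : X ⟶ Y), T.Sub f → K.Sub (F.map f)
  map_cov : ∀ ⦃X : C⦄ (S : Presieve X), S ∈ T.Cov X → Presieve.map F S ∈ K.Cov (F.obj X)
  map_pullback : ∀ ⦃P U X Y : C⦄ (p : P ⟶ X) (q : P ⟶ U) (f : X ⟶ Y) (b : U ⟶ Y), T.Sub b →
    IsPullback p q f b → IsPullback (F.map p) (F.map q) (F.map f) (F.map b)

/-- A *globalization* of a local structure `(C, T)`: a fully faithful continuous functor `F` to a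
global structure `(D, K)` such that `T` is the restriction of `K`, every object of `D` is covered
by objects of `C`, and `F` is universal among continuous functors from `C` to global structures:
for each global structure `(E, L)`, restriction along `F` is an equivalence
from the category of continuous functors `D ⥤ E` to the category of continuous functors
`C ⥤ E` (with all natural transformations as morphisms). -/
structure IsGlobalization {C : Type w₁} [Category.{v₁} C] {D : Type w₂} [Category.{v₂} D]
    (T : CatTopology C) (K : CatTopology D) (F : C ⥤ D) : Prop where
  source : CatTopology.IsLocalStructure.{u} T
  target : CatTopology.IsGlobalStructure.{u} K
  continuous : IsContinuousFunctor T K F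
  full : F.Full
  faithful : F.Faithful
  sub_iff : ∀ ⦃X Y : C⦄ (f : X ⟶ Y), T.Sub f ↔ K.Sub (F.map f)
  cov_iff : ∀ ⦃X : C⦄ (S : Presieve X), S ∈ T.Cov X ↔ Presieve.map F S ∈ K.Cov (F.obj X)
  covered : ∀ Y : D, ∃ (J : Type u) (U : J → C) (θ : ∀ j, F.obj (U j) ⟶ Y),
    Presieve.ofArrows (fun j => F.obj (U j)) θ ∈ K.Cov Y
  exists_extension : ∀ (E : Type w) [Category.{v} E] (L : CatTopology E),
    CatTopology.IsGlobalStructure.{u} L → ∀ G : C ⥤ E, IsContinuousFunctor T L G →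
      ∃ G' : D ⥤ E, IsContinuousFunctor K L G' ∧ Nonempty (F ⋙ G' ≅ G)
  restrict_bijective : ∀ (E : Type w) [Category.{v} E] (L : CatTopology E),
    CatTopology.IsGlobalStructure.{u} L → ∀ G₁ G₂ : D ⥤ E,
      IsContinuousFunctor K L G₁ → IsContinuousFunctor K L G₂ →
        Function.Bijective (fun α : G₁ ⟶ G₂ => Functor.whiskerLeft F α)

/-! ### Pseudogeometric topologies -/

/-- The pseudogeometric topology on a category of topological spaces: formal subsets are the
morphisms which are open embeddings, and covers are the non-empty cones of
open embeddings which are jointly surjective. -/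
def pseudogeometric {C : Type w} [Category.{v} C] (V : C ⥤ TopCat.{u}) : CatTopology C where
  Sub := fun _ _ f => IsOpenEmbedding (V.map f)
  Cov := fun X => {S | (∃ (Y : C) (s : Y ⟶ X), S s) ∧
    (∀ ⦃Y : C⦄ (s : Y ⟶ X), S s → IsOpenEmbedding (V.map s)) ∧
    ∀ x : V.obj X, ∃ (Y : C) (s : Y ⟶ X), S s ∧ x ∈ Set.range (V.map s)}

/-- The pseudogeometric topology on `Gen`. -/
def Gen.topology : CatTopology Gen.{u} := pseudogeometric Gen.toTop

/-- The pseudogeometric topology on `HGen`. -/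
def HGen.topology : CatTopology HGen.{u} :=
  pseudogeometric (Gen.hausdorff.ι ⋙ Gen.toTop)

/-- The pseudogeometric topology on `HGen⁺`. -/
def HGenPlus.topology : CatTopology HGenPlus.{u} :=
  pseudogeometric (Gen.locallyHausdorff.ι ⋙ Gen.toTop)

/-! Negligibility and diffuseness are local. In a locally connected space, whether an open subset
meets connected open sets in connected sets can be tested on small connected open sets
(`isConnected_inter_of_locally`). Hence open embeddings are diffuse, a function that is diffuse on
an open cover is diffuse (`IsDiffuse.of_cover`), and an open embedding can be cancelled from the
left of a diffuse composite (`IsDiffuse.of_comp_isOpenEmbedding`). From these facts on, diffuse maps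
behave towards open subspaces exactly as continuous maps do: a formal subset is determined by its
range, its pullbacks are preimages, and morphisms glue.

All three categories are full subcategories of `Gen` closed under open subspaces, and `HasOpens`
treats them at once: any such category is a local structure. Covering morphisms are isomorphisms,
which disposes of most conditions on `Cvm`. A canopy is an equivalence relation on the points of a
disjoint union, and the quotient is a locally connected space containing the pieces as open
subspaces. This quotient is an affinization whenever it stays in the category. It does so in `Gen`
and `HGenPlus`, but gluing can destroy the Hausdorff property.

For the globalization, every locally Hausdorff `X` has a set-sized atlas of all its open embeddings
from Hausdorff spaces. A continuous functor `G` to a global structure sends the atlas to a canopy,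
which has an affinization `Z`. Since the topology is intrinsic, `Z` is the colimit of `G` over all
morphisms from Hausdorff spaces to `X`, so the extension is the pointwise left Kan extension; the
same computation gives bijectivity on natural transformations. The longest part is the continuity of
the extension: fibered products along open embeddings are reduced, by passing to covers, to those in
an atlas or among Hausdorff spaces, and CLCS (ii) then gives preservation of formal subsets. -/

/-! ### Negligible subset elements and diffuse maps -/

/-- In a locally connected space, connectedness of `C ∩ S` for a connected open set `C` can be
checked locally on `C`. -/
theorem isConnected_inter_of_locally {X : Type u} [TopologicalSpace X] [LocallyConnectedSpace X]
    {C S : Set X} (hC : IsOpen C) (hC' : _root_.IsConnected C)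
    (h : ∀ x ∈ C, ∃ N, IsOpen N ∧ x ∈ N ∧
      ∀ D ⊆ N ∩ C, IsOpen D → _root_.IsConnected D → _root_.IsConnected (D ∩ S)) :
    _root_.IsConnected (C ∩ S) := by
  have key : ∀ (x : X) (O : Set X), IsOpen O → x ∈ O →
      ∃ D ⊆ O, IsOpen D ∧ x ∈ D ∧ _root_.IsConnected D :=
    fun x O hO hx => by
      obtain ⟨D, hD, h1, h2, h3⟩ :=
        locallyConnectedSpace_iff_subsets_isOpen_isConnected.1 ‹_› x O (hO.mem_nhds hx)
      exact ⟨D, hD, h1, h2, h3⟩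
  let good : Set X → Prop := fun D => IsOpen D ∧ D ⊆ C ∧
    ∀ D' ⊆ D, IsOpen D' → _root_.IsConnected D' → _root_.IsConnected (D' ∩ S)
  have hgood : ∀ x ∈ C, ∃ D, good D ∧ x ∈ D ∧ _root_.IsConnected D := by
    intro x hx
    obtain ⟨N, hN, hxN, hN'⟩ := h x hx
    obtain ⟨D, hD, hDo, hxD, hDc⟩ := key x (N ∩ C) (hN.inter hC) ⟨hxN, hx⟩
    exact ⟨D, ⟨hDo, hD.trans Set.inter_subset_right, fun D' hD' => hN' D' (hD'.trans hD)⟩, hxD, hDc⟩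
  refine ⟨?_, ?_⟩
  · obtain ⟨x, hx⟩ := hC'.1
    obtain ⟨D, ⟨hDo, hDC, hD⟩, -, hDc⟩ := hgood x hx
    obtain ⟨y, hy⟩ := (hD D subset_rfl hDo hDc).1
    exact ⟨y, hDC hy.1, hy.2⟩
  · intro u v hu hv huv ⟨a, ha, hau⟩ ⟨b, hb, hbv⟩
    by_contra hne
    rw [Set.not_nonempty_iff_eq_empty] at hne
    -- Given a separation of `C ∩ S` by `u` and `v`, each connected good set has its trace on `S` on
    -- one side. The unions of the good sets of either side are open and cover `C`, so they overlap.
    -- A small connected set in the overlap meets `S`, inside both `u` and `v`.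
    have dich : ∀ D, good D → _root_.IsConnected D → D ∩ S ⊆ u ∨ D ∩ S ⊆ v := by
      intro D hD hDc
      have hsub : D ∩ S ⊆ C ∩ S := Set.inter_subset_inter_left _ hD.2.1
      refine isPreconnected_iff_subset_of_disjoint.1
        (hD.2.2 D subset_rfl hD.1 hDc).isPreconnected u v hu hv (hsub.trans huv) ?_
      exact Set.subset_empty_iff.1 ((Set.inter_subset_inter_left _ hsub).trans hne.subset)
    let part : Set X → Set X := fun u => ⋃₀ {D | good D ∧ D ∩ S ⊆ u}
    have hopen : ∀ u, IsOpen (part u) := fun u => isOpen_sUnion fun D hD => hD.1.1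
    obtain ⟨x, hxC, ⟨D₁, ⟨hD₁, hD₁u⟩, hx₁⟩, ⟨D₂, ⟨hD₂, hD₂v⟩, hx₂⟩⟩ :=
      hC'.isPreconnected (part u) (part v) (hopen u) (hopen v)
        (fun x hx => by
          obtain ⟨D, hD, hxD, hDc⟩ := hgood x hx
          rcases dich D hD hDc with hd | hd
          · exact Or.inl ⟨D, ⟨hD, hd⟩, hxD⟩
          · exact Or.inr ⟨D, ⟨hD, hd⟩, hxD⟩)
        (by
          obtain ⟨D, hD, hxD, hDc⟩ := hgood a ha.1
          rcases dich D hD hDc with hd | hd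
          · exact ⟨a, ha.1, D, ⟨hD, hd⟩, hxD⟩
          · exact absurd (show a ∈ C ∩ S ∩ (u ∩ v) from ⟨ha, hau, hd ⟨hxD, ha.2⟩⟩) (by simp [hne]))
        (by
          obtain ⟨D, hD, hxD, hDc⟩ := hgood b hb.1
          rcases dich D hD hDc with hd | hd
          · exact absurd (show b ∈ C ∩ S ∩ (u ∩ v) from ⟨hb, hd ⟨hxD, hb.2⟩, hbv⟩) (by simp [hne])
          · exact ⟨b, hb.1, D, ⟨hD, hd⟩, hxD⟩)
    obtain ⟨E, hE, hEo, hxE, hEc⟩ := key x (D₁ ∩ D₂) (hD₁.1.inter hD₂.1) ⟨hx₁, hx₂⟩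
    obtain ⟨y, hyE, hyS⟩ := (hD₁.2.2 E (hE.trans Set.inter_subset_left) hEo hEc).1
    have : y ∈ C ∩ S ∩ (u ∩ v) :=
      ⟨⟨hD₁.2.1 (hE hyE).1, hyS⟩, hD₁u ⟨(hE hyE).1, hyS⟩, hD₂v ⟨(hE hyE).2, hyS⟩⟩
    simp [hne] at this

/-- Negligible subset elements of a locally connected space in terms of the ambient space. -/
theorem isNegligibleElement_iff {X : Type u} [TopologicalSpace X] [LocallyConnectedSpace X]
    {U I : Set X} :
    IsNegligibleElement U I ↔ IsOpen U ∧ I ⊆ U ∧ IsOpen (U \ I) ∧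
      ∀ C ⊆ U, IsOpen C → _root_.IsConnected C → _root_.IsConnected (C \ I) := by
  have aux : ∀ C : Set U, Subtype.val '' ((Subtype.val ⁻¹' I : Set U)ᶜ ∩ C) =
      (Subtype.val '' C) \ I := by
    intro C
    ext x
    simp only [Set.mem_image, Set.mem_inter_iff, Set.mem_compl_iff, Set.mem_preimage,
      Set.mem_sdiff]
    constructor
    · rintro ⟨y, ⟨h1, h2⟩, rfl⟩
      exact ⟨⟨y, h2, rfl⟩, h1⟩
    · rintro ⟨⟨y, h2, rfl⟩, h1⟩
      exact ⟨y, ⟨h1, h2⟩, rfl⟩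
  have conn : ∀ S : Set U, _root_.IsConnected (Subtype.val '' S) ↔ _root_.IsConnected S := fun S =>
    by
    simp only [_root_.IsConnected, Set.image_nonempty, IsInducing.subtypeVal.isPreconnected_image]
  constructor
  · intro h
    refine ⟨h.isOpen, h.subset, ?_, ?_⟩
    · have := h.isOpen.isOpenMap_subtype_val _ h.negligible.1
      have h2 := aux Set.univ
      rw [Set.inter_univ, Set.image_univ, Subtype.range_val] at h2
      rwa [h2] at this
    · intro C hC hCo hCc
      have e : Subtype.val '' (Subtype.val ⁻¹' C : Set U) = C := by simpa using hC
      have := h.negligible.2 (Subtype.val ⁻¹' C) (hCo.preimage continuous_subtype_val)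
        ((conn _).1 (by rwa [e]))
      rw [← conn, aux, e] at this
      exact this
  · rintro ⟨h1, h2, h3, h4⟩
    refine ⟨h1, h2, h1.isOpenEmbedding_subtypeVal.locallyConnectedSpace, ?_, ?_⟩
    · convert h3.preimage (continuous_subtype_val (p := fun x => x ∈ U)) using 1
      ext x
      simp
    · intro C hC hCc
      rw [← conn, aux]
      exact h4 _ (by rintro _ ⟨x, -, rfl⟩; exact x.2) (h1.isOpenMap_subtype_val _ hC)
        ((conn _).2 hCc)

/-- A map which is continuous around each point of a jointly surjective family of open embeddings
is continuous. -/
theorem continuous_of_isOpenEmbedding_cover {X Y : Type u} [TopologicalSpace X]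
    [TopologicalSpace Y] {f : X → Y}
    (h : ∀ x : X, ∃ (V : Type u) (_ : TopologicalSpace V) (b : V → X), IsOpenEmbedding b ∧
      x ∈ Set.range b ∧ Continuous (f ∘ b)) : Continuous f := by
  rw [continuous_iff_continuousAt]
  intro x
  obtain ⟨V, _, b, hb, ⟨y, rfl⟩, hc⟩ := h x
  exact hb.continuousAt_iff.1 hc.continuousAt

theorem Topology.IsOpenEmbedding.isConnected_image_iff {X Y : Type u}
    [TopologicalSpace X] [TopologicalSpace Y] {b : X → Y} (hb : IsOpenEmbedding b)
    {S : Set X} : _root_.IsConnected (b '' S) ↔ _root_.IsConnected S := by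
  simp only [_root_.IsConnected, Set.image_nonempty, hb.isInducing.isPreconnected_image]

section

variable {X Y : Type u} [TopologicalSpace X] [TopologicalSpace Y]
  [LocallyConnectedSpace X] [LocallyConnectedSpace Y]

/-- Open embeddings are diffuse. -/
theorem IsDiffuse.of_isOpenEmbedding {b : X → Y} (hb : IsOpenEmbedding b) : IsDiffuse b := by
  refine ⟨hb.continuous, fun U I h => ?_⟩
  rw [isNegligibleElement_iff] at h ⊢
  obtain ⟨h1, h2, h3, h4⟩ := h
  refine ⟨h1.preimage hb.continuous, Set.preimage_mono h2, h3.preimage hb.continuous,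
    fun C hC hCo hCc => ?_⟩
  have := h4 (b '' C) (by rintro _ ⟨x, hx, rfl⟩; exact hC hx) (hb.isOpenMap _ hCo)
    (hb.isConnected_image_iff.2 hCc)
  rwa [← Set.image_sdiff_preimage, hb.isConnected_image_iff] at this

/-- Serves to cancel open embeddings: a negligible element of the source is the preimage of its
image, so it can be pulled back through the composite. -/
theorem IsNegligibleElement.image {b : X → Y} (hb : IsOpenEmbedding b) {U I : Set X}
    (h : IsNegligibleElement U I) : IsNegligibleElement (b '' U) (b '' I) := by
  rw [isNegligibleElement_iff] at h ⊢
  obtain ⟨h1, h2, h3, h4⟩ := h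
  refine ⟨hb.isOpenMap _ h1, Set.image_mono h2, ?_, fun C hC hCo hCc => ?_⟩
  · rw [← Set.image_sdiff hb.injective]
    exact hb.isOpenMap _ h3
  · have e : b '' (b ⁻¹' C) = C :=
      Set.image_preimage_eq_of_subset (hC.trans (Set.image_subset_range _ _))
    rw [← e, ← Set.image_sdiff hb.injective, hb.isConnected_image_iff]
    refine h4 _ ?_ (hCo.preimage hb.continuous) (hb.isConnected_image_iff.1 (by rwa [e]))
    rw [← Set.preimage_image_eq U hb.injective]
    exact Set.preimage_mono hC

/-- Diffuseness is local on the source. -/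
theorem IsDiffuse.of_cover {f : X → Y}
    (h : ∀ x : X, ∃ (V : Type u) (_ : TopologicalSpace V) (_ : LocallyConnectedSpace V)
      (b : V → X), IsOpenEmbedding b ∧ x ∈ Set.range b ∧ IsDiffuse (f ∘ b)) : IsDiffuse f := by
  have hf : Continuous f := continuous_of_isOpenEmbedding_cover fun x => by
    obtain ⟨V, i1, _, b, hb, hx, hd⟩ := h x
    exact ⟨V, i1, b, hb, hx, hd.continuous⟩
  refine ⟨hf, fun U I hUI => ?_⟩
  have hUI' := hUI
  rw [isNegligibleElement_iff] at hUI ⊢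
  obtain ⟨h1, h2, h3, -⟩ := hUI
  refine ⟨h1.preimage hf, Set.preimage_mono h2, h3.preimage hf, fun C hC hCo hCc => ?_⟩
  rw [Set.sdiff_eq]
  refine isConnected_inter_of_locally hCo hCc fun x _ => ?_
  obtain ⟨V, _, _, b, hb, hx, hd⟩ := h x
  refine ⟨Set.range b, hb.isOpen_range, hx, fun D hD hDo hDc => ?_⟩
  have h5 := (isNegligibleElement_iff.1 (hd.pullback U I hUI')).2.2.2
  have e : b '' (b ⁻¹' D) = D :=
    Set.image_preimage_eq_of_subset (hD.trans Set.inter_subset_left)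
  have h6 := h5 (b ⁻¹' D) (fun y hy => hC (hD hy).2) (hDo.preimage hb.continuous)
    (hb.isConnected_image_iff.1 (by rwa [e]))
  rw [← Set.sdiff_eq, ← e, ← Set.image_sdiff_preimage, hb.isConnected_image_iff]
  exact h6

end

/-- A map is diffuse if its composite with an open embedding is. -/
theorem IsDiffuse.of_comp_isOpenEmbedding {X Y Z : Type u} [TopologicalSpace X]
    [TopologicalSpace Y] [TopologicalSpace Z] [LocallyConnectedSpace Y] [LocallyConnectedSpace Z]
    {b : Y → Z} (hb : IsOpenEmbedding b) {f : X → Y}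
    (h : IsDiffuse (b ∘ f)) : IsDiffuse f := by
  refine ⟨hb.isInducing.continuous_iff.2 h.continuous, fun U I hUI => ?_⟩
  have := h.pullback _ _ (hUI.image hb)
  rwa [Set.preimage_comp, Set.preimage_comp, Set.preimage_image_eq _ hb.injective,
    Set.preimage_image_eq _ hb.injective] at this

/-! ### Categories of spaces with open subspaces -/

namespace Gen

/-- The open subspace of a locally connected space on a given open set. -/
def restrict (X : Gen.{u}) (O : Set X.carrier) (hO : IsOpen O) : Gen.{u} :=
  haveI : LocallyConnectedSpace O := hO.isOpenEmbedding_subtypeVal.locallyConnectedSpace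
  ⟨O⟩

/-- The inclusion of an open subspace. -/
def restrictι (X : Gen.{u}) (O : Set X.carrier) (hO : IsOpen O) : X.restrict O hO ⟶ X :=
  haveI : LocallyConnectedSpace O := hO.isOpenEmbedding_subtypeVal.locallyConnectedSpace
  ⟨Subtype.val, IsDiffuse.of_isOpenEmbedding hO.isOpenEmbedding_subtypeVal⟩

section

variable {C : Type w} [Category.{v} C] (I : C ⥤ Gen.{u})

/-- The underlying set of an object. -/
abbrev pts (X : C) : Type u := (I.obj X).carrier

/-- The underlying function of a morphism. -/
def fn {X Y : C} (f : X ⟶ Y) : pts I X → pts I Y := (I.map f).toFun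

/-- `I` realizes `C` as a full subcategory of `Gen` closed under open subspaces. -/
structure HasOpens : Prop where
  full : I.Full
  faithful : I.Faithful
  exists_restrict : ∀ (X : C) (O : Set (pts I X)), IsOpen O →
    ∃ (U : C) (i : U ⟶ X), IsOpenEmbedding (fn I i) ∧ Set.range (fn I i) = O

@[simp] theorem fn_comp {X Y Z : C} (f : X ⟶ Y) (g : Y ⟶ Z) (x : pts I X) :
    fn I (f ≫ g) x = fn I g (fn I f x) := by
  unfold fn
  rw [I.map_comp]
  rfl

@[simp] theorem fn_id (X : C) (x : pts I X) : fn I (𝟙 X) x = x := by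
  unfold fn
  rw [I.map_id]
  rfl

theorem fn_comp' {X Y Z : C} (f : X ⟶ Y) (g : Y ⟶ Z) : fn I (f ≫ g) = fn I g ∘ fn I f :=
  funext fun x => fn_comp I f g x

theorem fn_diffuse {X Y : C} (f : X ⟶ Y) : IsDiffuse (fn I f) := (I.map f).diffuse

/-- The open embeddings. -/
def opens : MorphismProperty C := fun _ _ f => IsOpenEmbedding (fn I f)

theorem fn_isHomeomorph {X Y : C} (f : X ⟶ Y) [IsIso f] : IsHomeomorph (fn I f) := by
  rw [isHomeomorph_iff_exists_inverse]
  refine ⟨(fn_diffuse I f).continuous, fn I (inv f), fun x => ?_, fun x => ?_,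
    (fn_diffuse I (inv f)).continuous⟩ <;> simp [← fn_comp]

namespace HasOpens

variable {I}

theorem fn_injective (hI : HasOpens I) {X Y : C} {f g : X ⟶ Y} (h : fn I f = fn I g) : f = g :=
  have := hI.faithful
  I.map_injective (Gen.Hom.ext h)

theorem exists_hom (hI : HasOpens I) {X Y : C} (f : pts I X → pts I Y) (hf : IsDiffuse f) :
    ∃ g : X ⟶ Y, fn I g = f :=
  have := hI.full
  ⟨I.preimage (show I.obj X ⟶ I.obj Y from ⟨f, hf⟩), by unfold fn; rw [I.map_preimage]⟩

theorem mono (hI : HasOpens I) {X Y : C} {b : X ⟶ Y} (hb : opens I b) : Mono b where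
  right_cancellation f g h := hI.fn_injective (funext fun x => hb.injective (by
    simpa using congrArg (fun k => fn I k x) h))

/-- The factorization of underlying functions is automatically diffuse, because the open embedding
`b` can be cancelled. Hence formal subsets are controlled by their ranges alone. -/
theorem exists_lift (hI : HasOpens I) {T U Y : C} {b : U ⟶ Y} (hb : opens I b) (f : T ⟶ Y)
    (h : Set.range (fn I f) ⊆ Set.range (fn I b)) : ∃ l : T ⟶ U, l ≫ b = f := by
  choose l hl using fun x => h ⟨x, rfl⟩
  have e : fn I b ∘ l = fn I f := funext hl
  obtain ⟨g, hg⟩ := hI.exists_hom l (IsDiffuse.of_comp_isOpenEmbedding hb (e ▸ fn_diffuse I f))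
  exact ⟨g, hI.fn_injective (by rw [fn_comp', hg, e])⟩

theorem isIso (hI : HasOpens I) {X Y : C} {b : X ⟶ Y} (hb : opens I b)
    (hs : Function.Surjective (fn I b)) :
    IsIso b := by
  obtain ⟨l, hl⟩ := hI.exists_lift hb (𝟙 Y) (by rw [hs.range_eq]; exact Set.subset_univ _)
  have := hI.mono hb
  exact ⟨l, by rw [← cancel_mono b, Category.assoc, hl]; simp, hl⟩

theorem opens_of_isIso {X Y : C} (f : X ⟶ Y) [IsIso f] : opens I f :=
  (fn_isHomeomorph I f).isOpenEmbedding

theorem opens_comp {X Y Z : C} {f : X ⟶ Y} {g : Y ⟶ Z} (hf : opens I f) (hg : opens I g) :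
    opens I (f ≫ g) := by
  unfold opens
  rw [fn_comp']
  exact hg.comp hf

theorem opens_of_comp {X Y Z : C} {f : X ⟶ Y} {g : Y ⟶ Z} (hg : opens I g)
    (h : opens I (f ≫ g)) : opens I f := by
  unfold opens at h
  rw [fn_comp'] at h
  exact (hg.of_comp_iff _).1 h

/-- Because `p` and `b` are monomorphisms, a lift only has to match the first leg of a cone, and it
exists by comparison of ranges. -/
theorem isPullback_of (hI : HasOpens I) {P U X Y : C} {p : P ⟶ X} {q : P ⟶ U} {f : X ⟶ Y}
    {b : U ⟶ Y}
    (hb : opens I b) (w : p ≫ f = q ≫ b) (hp : opens I p)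
    (hr : Set.range (fn I p) = fn I f ⁻¹' Set.range (fn I b)) : IsPullback p q f b := by
  have := hI.mono hb
  have := hI.mono hp
  have key : ∀ s : PullbackCone f b, ∃ l : s.pt ⟶ P, l ≫ p = s.fst := fun s => by
    refine hI.exists_lift hp s.fst ?_
    rw [hr]
    rintro _ ⟨x, rfl⟩
    exact ⟨fn I s.snd x, by simpa using (congrArg (fun k => fn I k x) s.condition).symm⟩
  choose l hl using key
  refine ⟨⟨w⟩, ⟨PullbackCone.IsLimit.mk w l hl (fun s => ?_) (fun s m h1 _ => ?_)⟩⟩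
  · rw [← cancel_mono b, Category.assoc, ← w, ← Category.assoc, hl, s.condition]
  · rw [← cancel_mono p, h1, hl]

theorem exists_isPullback (hI : HasOpens I) {U X Y : C} (f : X ⟶ Y) {b : U ⟶ Y} (hb : opens I b) :
    ∃ (P : C) (p : P ⟶ X) (q : P ⟶ U), IsPullback p q f b ∧ opens I p ∧
      Set.range (fn I p) = fn I f ⁻¹' Set.range (fn I b) := by
  obtain ⟨P, p, hp, hr⟩ := hI.exists_restrict X (fn I f ⁻¹' Set.range (fn I b))
    (hb.isOpen_range.preimage (fn_diffuse I f).continuous)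
  obtain ⟨q, hq⟩ := hI.exists_lift hb (p ≫ f) (by
    rintro _ ⟨x, rfl⟩
    rw [fn_comp]
    exact hr.subset ⟨x, rfl⟩)
  exact ⟨P, p, q, hI.isPullback_of hb hq.symm hp hr, hp, hr⟩

theorem opens_range_of_isPullback (hI : HasOpens I) {P U X Y : C} {p : P ⟶ X} {q : P ⟶ U}
    {f : X ⟶ Y} {b : U ⟶ Y}
    (hb : opens I b) (h : IsPullback p q f b) :
    opens I p ∧ Set.range (fn I p) = fn I f ⁻¹' Set.range (fn I b) := by
  obtain ⟨P', p', q', h', hp', hr'⟩ := hI.exists_isPullback f hb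
  have e : (h.isoIsPullback _ _ h').hom ≫ p' = p := by simp
  rw [← e]
  refine ⟨opens_comp (opens_of_isIso _) hp', ?_⟩
  rw [fn_comp', Set.range_comp, (fn_isHomeomorph I _).surjective.range_eq, Set.image_univ, hr']

/-- Allows fibered products along open embeddings, and hence the canopy axioms, to be read on
points. -/
theorem exists_pt_of_isPullback (hI : HasOpens I) {P U X Y : C} {p : P ⟶ X} {q : P ⟶ U}
    {f : X ⟶ Y} {b : U ⟶ Y}
    (hb : opens I b) (h : IsPullback p q f b) {x : pts I X} {y : pts I U}
    (hxy : fn I f x = fn I b y) : ∃ z, fn I p z = x ∧ fn I q z = y := by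
  obtain ⟨z, rfl⟩ : x ∈ Set.range (fn I p) := by
    rw [(hI.opens_range_of_isPullback hb h).2]
    exact ⟨y, hxy.symm⟩
  exact ⟨z, rfl, hb.injective (by rw [← fn_comp, ← h.w, fn_comp, hxy])⟩

end HasOpens

/-- The pseudogeometric topology, in terms of underlying functions. -/
theorem mem_cov_iff {X : C} {S : Presieve X} :
    S ∈ (pseudogeometric (I ⋙ Gen.toTop)).Cov X ↔ (∃ (Y : C) (s : Y ⟶ X), S s) ∧
      (∀ ⦃Y : C⦄ (s : Y ⟶ X), S s → opens I s) ∧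
      ∀ x : pts I X, ∃ (Y : C) (s : Y ⟶ X), S s ∧ x ∈ Set.range (fn I s) :=
  Iff.rfl

end

end Gen

namespace Gen

namespace HasOpens

variable {C : Type w} [Category.{v} C] {I : C ⥤ Gen.{u}}

/-! ### The pseudogeometric topology is a local structure -/

theorem ofArrows_mem_cov_iff {J : Type u} {X : C} {U : J → C} {θ : ∀ j, U j ⟶ X} :
    Presieve.ofArrows U θ ∈ (pseudogeometric (I ⋙ Gen.toTop)).Cov X ↔
      Nonempty J ∧ (∀ j, opens I (θ j)) ∧ ∀ x, ∃ j y, fn I (θ j) y = x := by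
  rw [mem_cov_iff]
  constructor
  · rintro ⟨⟨_, _, ⟨j⟩⟩, h2, h3⟩
    refine ⟨⟨j⟩, fun j => h2 _ ⟨j⟩, fun x => ?_⟩
    obtain ⟨_, _, ⟨j⟩, y, hy⟩ := h3 x
    exact ⟨j, y, hy⟩
  · rintro ⟨⟨j⟩, h2, h3⟩
    refine ⟨⟨_, _, ⟨j⟩⟩, ?_, fun x => ?_⟩
    · rintro _ _ ⟨j⟩
      exact h2 j
    · obtain ⟨j, y, hy⟩ := h3 x
      exact ⟨_, _, ⟨j⟩, y, hy⟩

theorem singleton_mem_cov_iff {X Y : C} {b : X ⟶ Y} :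
    Presieve.singleton b ∈ (pseudogeometric (I ⋙ Gen.toTop)).Cov Y ↔
      opens I b ∧ Function.Surjective (fn I b) := by
  rw [mem_cov_iff]
  constructor
  · rintro ⟨-, h2, h3⟩
    refine ⟨h2 _ ⟨⟩, fun y => ?_⟩
    obtain ⟨_, _, ⟨⟩, hy⟩ := h3 y
    exact hy
  · rintro ⟨h1, h2⟩
    refine ⟨⟨_, _, ⟨⟩⟩, ?_, fun x => ⟨_, _, ⟨⟩, h2 x⟩⟩
    rintro _ _ ⟨⟩
    exact h1

/-- A single formal subset covers only if it is a surjective open embedding, and the inverse of such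
a map is again diffuse. -/
theorem cvm_iff (hI : HasOpens I) {X Y : C} {b : X ⟶ Y} :
    (pseudogeometric (I ⋙ Gen.toTop)).Cvm b ↔ IsIso b := by
  unfold CatTopology.Cvm
  rw [singleton_mem_cov_iff]
  exact ⟨fun h => hI.isIso h.1 h.2.2, fun h =>
    ⟨opens_of_isIso b, opens_of_isIso b, (fn_isHomeomorph I b).surjective⟩⟩

theorem isTopology (hI : HasOpens I) : (pseudogeometric (I ⋙ Gen.toTop)).IsTopology where
  sub :=
    { of_isIso := fun X Y f _ => opens_of_isIso f
      comp := fun X Y Z f g hf hg => opens_comp hf hg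
      pullbackBase := fun U X Y b f hb => by
        obtain ⟨P, p, q, h, -⟩ := hI.exists_isPullback f hb
        exact h.hasPullback
      pullback_mem := fun P U X Y p q f b h hb => (hI.opens_range_of_isPullback hb h).1 }
  cov_isSubCone X S hS := hS.2.1
  cov_nonempty X S hS := hS.1
  cov_mono := by
    rintro X S R ⟨⟨Y, s, hs⟩, -, h3⟩ hSR hR
    refine ⟨⟨Y, s, hSR _ _ hs⟩, hR, fun x => ?_⟩
    obtain ⟨Y, s, hs, hx⟩ := h3 x
    exact ⟨Y, s, hSR _ _ hs, hx⟩
  cov_iso X Y b hb := singleton_mem_cov_iff.2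
    ⟨opens_of_isIso b, (fn_isHomeomorph I b).surjective⟩
  cov_bind := by
    intro X S θ hS hθ
    rw [mem_cov_iff] at hS ⊢
    obtain ⟨⟨Y, s, hs⟩, h2, h3⟩ := hS
    refine ⟨?_, ?_, fun x => ?_⟩
    · obtain ⟨Z, t, ht⟩ := (hθ hs).1
      exact ⟨Z, t ≫ s, Y, t, s, hs, ht, rfl⟩
    · rintro Z _ ⟨Y, t, s, hs, ht, rfl⟩
      exact opens_comp (((mem_cov_iff I).1 (hθ hs)).2.1 t ht) (h2 s hs)
    · obtain ⟨Y, s, hs, y, rfl⟩ := h3 x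
      obtain ⟨Z, t, ht, z, rfl⟩ := ((mem_cov_iff I).1 (hθ hs)).2.2 y
      exact ⟨Z, t ≫ s, ⟨Y, t, s, hs, ht, rfl⟩, z, by simp⟩
  cov_pullback := by
    intro X Y f S R hS h1 h2
    rw [mem_cov_iff] at hS ⊢
    obtain ⟨⟨U, s, hs⟩, h3, h4⟩ := hS
    refine ⟨?_, ?_, fun x => ?_⟩
    · obtain ⟨P, p, q, hp, -⟩ := h1 s hs
      exact ⟨P, p, hp⟩
    · intro P p hp
      obtain ⟨U, s, q, hs, h⟩ := h2 p hp
      exact (hI.opens_range_of_isPullback (h3 s hs) h).1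
    · obtain ⟨U, s, hs, y, hy⟩ := h4 (fn I f x)
      obtain ⟨P, p, q, hp, h⟩ := h1 s hs
      obtain ⟨z, hz, -⟩ := hI.exists_pt_of_isPullback (h3 s hs) h hy.symm
      exact ⟨P, p, hp, z, hz⟩
  cov_fst := by
    intro P X Y f π₁ π₂ hf h
    refine singleton_mem_cov_iff.2 ⟨(hI.opens_range_of_isPullback hf h).1, fun x => ?_⟩
    obtain ⟨z, hz, -⟩ := hI.exists_pt_of_isPullback hf h (x := x) rfl
    exact ⟨z, hz⟩
  cov_snd := by
    intro P X Y f π₁ π₂ hf h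
    refine singleton_mem_cov_iff.2 ⟨(hI.opens_range_of_isPullback hf h.flip).1, fun x => ?_⟩
    obtain ⟨z, hz, -⟩ := hI.exists_pt_of_isPullback hf h.flip (x := x) rfl
    exact ⟨z, hz⟩

/-- Up to isomorphism over `X`, an open embedding is its range, so the open subsets of `X` serve as
index set. -/
theorem isSmall (hI : HasOpens I) :
    CatTopology.IsSmall.{u} (pseudogeometric (I ⋙ Gen.toTop)) := by
  intro X
  choose U i hi hr using fun O : {O : Set (pts I X) // IsOpen O} =>
    hI.exists_restrict X O.1 O.2
  refine ⟨_, U, i, hi, fun Y s hs => ?_⟩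
  have hs' : opens I s := hs
  let O : {O : Set (pts I X) // IsOpen O} := ⟨_, hs'.isOpen_range⟩
  obtain ⟨l, hl⟩ := hI.exists_lift (hi O) s (hr O).symm.subset
  have : IsIso l := by
    refine hI.isIso (opens_of_comp (hi O) (hl ▸ hs')) fun y => ?_
    obtain ⟨x, hx⟩ := (hr O).subset ⟨y, rfl⟩
    exact ⟨x, (hi O).injective (by rw [← fn_comp, hl, hx])⟩
  exact ⟨O, asIso l, hl⟩

theorem isFlush : (pseudogeometric (I ⋙ Gen.toTop)).IsFlush := by
  intro X R S hR hS h
  rw [mem_cov_iff] at hR ⊢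
  obtain ⟨⟨Y, r, hr⟩, -, h3⟩ := hR
  refine ⟨?_, hS, fun x => ?_⟩
  · obtain ⟨Z, s, -, hs, -⟩ := h r hr
    exact ⟨Z, s, hs⟩
  · obtain ⟨Y, r, hr, y, rfl⟩ := h3 x
    obtain ⟨Z, s, g, hs, rfl⟩ := h r hr
    exact ⟨Z, s, hs, fn I g y, by simp⟩

theorem isIntrinsic (hI : HasOpens I) :
    CatTopology.IsIntrinsic.{u} (pseudogeometric (I ⋙ Gen.toTop)) := by
  intro J X A θ hθ hA
  rw [ofArrows_mem_cov_iff] at hθ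
  obtain ⟨-, h2, h3⟩ := hθ
  refine ⟨fun j k => (hA j k).w, fun Y f hf => ?_⟩
  choose j y hy using h3
  -- The glued function is defined through a chosen chart at each point; points of the overlaps
  -- `A[j,k]` show that the choice does not matter.
  have wd : ∀ j k a b, fn I (θ j) a = fn I (θ k) b → fn I (f j) a = fn I (f k) b := by
    intro j k a b hab
    obtain ⟨z, rfl, rfl⟩ := hI.exists_pt_of_isPullback (h2 k) (hA j k) hab
    rw [← fn_comp, hf, fn_comp]
  have hc : ∀ k, (fun x => fn I (f (j x)) (y x)) ∘ fn I (θ k) = fn I (f k) := fun k =>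
    funext fun a => wd _ _ _ _ (hy _)
  obtain ⟨g, hg⟩ := hI.exists_hom (fun x => fn I (f (j x)) (y x))
    (IsDiffuse.of_cover fun x => ⟨pts I (A.obj (j x)), inferInstance, inferInstance,
      fn I (θ (j x)), h2 _, ⟨_, hy x⟩, by rw [hc]; exact fn_diffuse I _⟩)
  refine ⟨g, fun k => hI.fn_injective (by rw [fn_comp', hg, hc]), fun g' hg' => ?_⟩
  refine hI.fn_injective (funext fun x => ?_)
  have e : fn I (θ (j x) ≫ g') (y x) = fn I (f (j x)) (y x) := by rw [hg' (j x)]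
  rw [fn_comp, hy] at e
  rw [hg, e]

/-- Isomorphisms are the bijective open embeddings, and injectivity, surjectivity and openness can
be tested over a cover of the target. In part (ii), openness is local on the source, while
injectivity comes from the isomorphism hypothesis: nothing outside the range of `s` has the same
image as a point of it. -/
theorem isCLCS (hI : HasOpens I) : (pseudogeometric (I ⋙ Gen.toTop)).IsCLCS where
  layered :=
    { formal :=
        { of_isIso := fun X Y f hf => hI.cvm_iff.2 hf
          comp := fun X Y Z f g hf hg => by
            rw [hI.cvm_iff] at *
            exact IsIso.comp_isIso
          pullbackBase := fun U X Y b f hb => by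
            obtain ⟨P, p, q, h, -⟩ := hI.exists_isPullback f hb.1
            exact h.hasPullback
          pullback_mem := fun P U X Y p q f b h hb => by
            rw [hI.cvm_iff] at *
            exact h.isIso_fst_of_isIso }
      local_target := by
        intro B A b S hS h
        rw [mem_cov_iff] at hS
        obtain ⟨-, h2, h3⟩ := hS
        -- Over the range of each `s`, inverting the covering morphism gives a lift `r` of `s`
        -- through `b` which fills the whole preimage.
        have key : ∀ a : pts I A, ∃ (U : C) (s : U ⟶ A) (r : U ⟶ B), a ∈ Set.range (fn I s) ∧
            opens I s ∧ r ≫ b = s ∧ opens I r ∧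
              Set.range (fn I r) = fn I b ⁻¹' Set.range (fn I s) := by
          intro a
          obtain ⟨U, s, hs, ha⟩ := h3 a
          obtain ⟨P, p, q, hp, hq⟩ := h s hs
          rw [hI.cvm_iff] at hq
          obtain ⟨h4, h5⟩ := hI.opens_range_of_isPullback (h2 s hs) hp
          refine ⟨U, s, inv q ≫ p, ha, h2 s hs, by simp [hp.w],
            opens_comp (opens_of_isIso _) h4, ?_⟩
          rw [fn_comp', Set.range_comp, (fn_isHomeomorph I _).surjective.range_eq,
            Set.image_univ, h5]
        have hsurj : Function.Surjective (fn I b) := fun a => by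
          obtain ⟨U, s, r, ⟨x, rfl⟩, -, rfl, -⟩ := key a
          exact ⟨fn I r x, by simp⟩
        have hinj : Function.Injective (fn I b) := fun x y hxy => by
          obtain ⟨U, s, r, ha, hs, hr, hr', hr''⟩ := key (fn I b x)
          obtain ⟨x', rfl⟩ := hr''.symm.subset ha
          obtain ⟨y', rfl⟩ := hr''.symm.subset
            (show y ∈ fn I b ⁻¹' Set.range (fn I s) by rwa [Set.mem_preimage, ← hxy])
          rw [← fn_comp, ← fn_comp, hr] at hxy
          rw [hs.injective hxy]
        have hopen : IsOpenMap (fn I b) := by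
          rw [isOpenMap_iff_nhds_le]
          intro x
          obtain ⟨U, s, r, ha, hs, hr, hr', hr''⟩ := key (fn I b x)
          obtain ⟨x', rfl⟩ := hr''.symm.subset ha
          rw [← fn_comp, hr, ← hr'.map_nhds_eq, Filter.map_map, ← fn_comp', hr,
            hs.map_nhds_eq]
        have hb : opens I b := .of_continuous_injective_isOpenMap
          (fn_diffuse I b).continuous hinj hopen
        rw [hI.cvm_iff]
        exact hI.isIso hb hsurj }
  sub_of_local := by
    intro B A b S hS h
    rw [mem_cov_iff] at hS
    obtain ⟨-, h2, h3⟩ := hS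
    refine .of_continuous_injective_isOpenMap (fn_diffuse I b).continuous (fun x y hxy => ?_) ?_
    · obtain ⟨U, s, hs, x', rfl⟩ := h3 x
      obtain ⟨hb, P, p, q, hp, hq⟩ := h s hs
      have hxy' : fn I b (fn I s x') = fn I b y := hxy
      -- Both `s x'` and `y`, paired with `x'`, are points of the pullback `P`; as `q` is bijective
      -- these points coincide.
      obtain ⟨z₁, hz₁, hz₁'⟩ := hI.exists_pt_of_isPullback hb hp (x := fn I s x') (y := x')
        (by simp)
      obtain ⟨z₂, hz₂, hz₂'⟩ := hI.exists_pt_of_isPullback hb hp (x := y) (y := x')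
        (by rw [← hxy']; simp)
      have : z₁ = z₂ := (fn_isHomeomorph I q).injective (hz₁'.trans hz₂'.symm)
      rw [← hz₂, ← this, hz₁]
    · refine isOpenMap_iff_nhds_le.2 fun x => ?_
      obtain ⟨U, s, hs, x', rfl⟩ := h3 x
      have hb : opens I (s ≫ b) := (h s hs).1
      change nhds (fn I b (fn I s x')) ≤ Filter.map (fn I b) (nhds (fn I s x'))
      rw [← (h2 s hs).map_nhds_eq, Filter.map_map, ← fn_comp', ← fn_comp, hb.map_nhds_eq]

/-- A pullback system of covering morphisms is an isomorphism of graphs, so the affinization is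
transported along it. -/
theorem isClosedUnder_cvm (hI : HasOpens I) :
    CatTopology.IsClosedUnder.{u} (pseudogeometric (I ⋙ Gen.toTop))
      (pseudogeometric (I ⋙ Gen.toTop)).Cvm := by
  rintro J Q A - - q q₂ h ⟨X, θ, hθ⟩
  have h1 : ∀ j, IsIso (q j) := fun j => hI.cvm_iff.1 (h.mem j)
  have h2 : ∀ j k, IsIso (q₂ j k) := fun j k => hI.cvm_iff.1 (h.mem₂ j k)
  obtain ⟨h3, h4, h5⟩ := ofArrows_mem_cov_iff.1 hθ.cov
  have h6 : ∀ j, opens I (q j ≫ θ j) := fun j => opens_comp (opens_of_isIso _) (h4 j)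
  refine ⟨X, fun j => q j ≫ θ j, h6, ofArrows_mem_cov_iff.2 ⟨h3, h6, fun x => ?_⟩,
    fun j k => ?_⟩
  · obtain ⟨j, y, rfl⟩ := h5 x
    obtain ⟨z, rfl⟩ := (fn_isHomeomorph I (q j)).surjective y
    exact ⟨j, z, by simp⟩
  · refine IsPullback.of_iso (hθ.canopyOf j k) (asIso (q₂ j k)).symm (asIso (q j)).symm
      (asIso (q k)).symm (Iso.refl X) ?_ ?_ ?_ ?_
    · rw [Iso.symm_hom, Iso.symm_hom, asIso_inv, asIso_inv, IsIso.eq_inv_comp, ← Category.assoc,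
        ← (h.isPullback₁ j k).w, Category.assoc, IsIso.hom_inv_id, Category.comp_id]
    · rw [Iso.symm_hom, Iso.symm_hom, asIso_inv, asIso_inv, IsIso.eq_inv_comp, ← Category.assoc,
        ← (h.isPullback₂ j k).w, Category.assoc, IsIso.hom_inv_id, Category.comp_id]
    · simp
    · simp

theorem isLocalStructure (hI : HasOpens I) :
    CatTopology.IsLocalStructure.{u} (pseudogeometric (I ⋙ Gen.toTop)) :=
  ⟨hI.isTopology, hI.isSmall, isFlush, hI.isIntrinsic, hI.isCLCS, hI.isClosedUnder_cvm⟩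

end HasOpens

end Gen

namespace Gen

/-! ### Gluing along canopies -/

theorem hasOpens_id : HasOpens (𝟭 Gen.{u}) where
  full := inferInstance
  faithful := inferInstance
  exists_restrict X O hO := ⟨X.restrict O hO, X.restrictι O hO, hO.isOpenEmbedding_subtypeVal,
    Subtype.range_val⟩

theorem hasOpens_ι (P : ObjectProperty Gen.{u})
    (hP : ∀ ⦃X Y : Gen.{u}⦄ (b : X.carrier → Y.carrier), IsOpenEmbedding b → P Y → P X) :
    HasOpens P.ι where
  full := inferInstance
  faithful := inferInstance
  exists_restrict X O hO := ⟨⟨X.obj.restrict O hO, hP Subtype.val hO.isOpenEmbedding_subtypeVal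
    X.property⟩, P.homMk (X.obj.restrictι O hO), hO.isOpenEmbedding_subtypeVal, Subtype.range_val⟩

theorem hasOpens_hausdorff : HasOpens Gen.hausdorff.{u}.ι :=
  hasOpens_ι _ fun _ _ _ hb hY =>
    have : T2Space _ := hY
    hb.isEmbedding.t2Space

theorem hasOpens_locallyHausdorff : HasOpens Gen.locallyHausdorff.{u}.ι := by
  refine hasOpens_ι _ fun X Y b hb ⟨𝒱, h1, h2⟩ => ⟨(fun V => b ⁻¹' V) '' 𝒱, ?_, ?_⟩
  · rintro _ ⟨V, hV, rfl⟩
    refine ⟨(h1 V hV).1.preimage hb.continuous, ?_⟩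
    have := (h1 V hV).2
    exact (hb.isEmbedding.restrictPreimage V).t2Space
  · refine Set.eq_univ_of_forall fun x => ?_
    obtain ⟨V, hV, hx⟩ := h2.symm.subset (Set.mem_univ (b x))
    exact ⟨_, ⟨V, hV, rfl⟩, hx⟩

namespace HasOpens

variable {C : Type w} [Category.{v} C] {I : C ⥤ Gen.{u}}

section Glue

variable {J : Type u} {A : CanopyGraph C J}

/-- The equivalence relation defined by a canopy on the points of its objects. -/
def canopySetoid (hI : HasOpens I) (hA : A.IsCanopy (pseudogeometric (I ⋙ Gen.toTop))) :
    Setoid (Σ j, pts I (A.obj j)) where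
  r a b := ∃ z : pts I (A.obj₂ a.1 b.1), fn I (A.ρ₁ _ _) z = a.2 ∧ fn I (A.ρ₂ _ _) z = b.2
  iseqv := by
    refine ⟨?_, ?_, ?_⟩
    · rintro ⟨j, x⟩
      obtain ⟨δ, h1, h2⟩ := hA.refl j
      exact ⟨fn I δ x, by simp [← fn_comp, h1], by simp [← fn_comp, h2]⟩
    · rintro ⟨j, x⟩ ⟨k, y⟩ h
      dsimp only at h ⊢
      obtain ⟨z, rfl, rfl⟩ := h
      obtain ⟨σ, h1, h2⟩ := hA.symm j k
      exact ⟨fn I σ z, by simp [← fn_comp, h1], by simp [← fn_comp, h2]⟩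
    · rintro ⟨i, a⟩ ⟨j, b⟩ ⟨k, c⟩ h h'
      dsimp only at h h' ⊢
      obtain ⟨z, rfl, hz⟩ := h
      obtain ⟨z', hz', rfl⟩ := h'
      obtain ⟨P, p, q, hP, -⟩ := hI.exists_isPullback (A.ρ₂ i j) (hA.sub₁ j k)
      obtain ⟨ω, h1, h2⟩ := hA.trans i j k p q hP
      obtain ⟨t, rfl, rfl⟩ := hI.exists_pt_of_isPullback (hA.sub₁ j k) hP (hz.trans hz'.symm)
      exact ⟨fn I ω t, by simp [← fn_comp, h1], by simp [← fn_comp, h2]⟩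

/-- The monomorphism `ρ₁` has the section `δ`, so it is inverse to `δ`, and `δ ≫ ρ₂ = 1` forces `ρ₂`
to agree with it. On points, the canopy identifies no two distinct points of the same piece. -/
theorem canopy_ρ₁_eq_ρ₂ (hI : HasOpens I)
    (hA : A.IsCanopy (pseudogeometric (I ⋙ Gen.toTop))) (j : J) : A.ρ₁ j j = A.ρ₂ j j := by
  obtain ⟨δ, h1, h2⟩ := hA.refl j
  have := hI.mono (hA.sub₁ j j)
  have h3 : A.ρ₁ j j ≫ δ = 𝟙 _ := by
    rw [← cancel_mono (A.ρ₁ j j), Category.assoc, h1]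
    simp
  calc A.ρ₁ j j = A.ρ₁ j j ≫ δ ≫ A.ρ₂ j j := by rw [h2, Category.comp_id]
    _ = A.ρ₂ j j := by rw [← Category.assoc, h3, Category.id_comp]

/-- Gluing of spaces along a canopy. -/
theorem exists_glue (hI : HasOpens I) (hA : A.IsCanopy (pseudogeometric (I ⋙ Gen.toTop))) :
    ∃ (X : Gen.{u}) (θ : ∀ j, pts I (A.obj j) → X.carrier), (∀ j, IsOpenEmbedding (θ j)) ∧
      (∀ x, ∃ j y, θ j y = x) ∧ ∀ j k x y, θ j x = θ k y ↔
        ∃ z, fn I (A.ρ₁ j k) z = x ∧ fn I (A.ρ₂ j k) z = y := by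
  let S := hI.canopySetoid hA
  let θ : ∀ j, pts I (A.obj j) → Quotient S := fun j x => Quotient.mk S ⟨j, x⟩
  have hsurj : ∀ x, ∃ j y, θ j y = x := by
    rintro ⟨j, y⟩
    exact ⟨j, y, rfl⟩
  have heq : ∀ j k x y, θ j x = θ k y ↔
      ∃ z, fn I (A.ρ₁ j k) z = x ∧ fn I (A.ρ₂ j k) z = y := fun j k x y => Quotient.eq
  have hopen : ∀ j, IsOpenMap (θ j) := by
    intro j O hO
    refine isOpen_coinduced.2 (isOpen_sigma_iff.2 fun k => ?_)
    -- The saturation of `O` in the piece `k` is `ρ₂ (ρ₁⁻¹ O)`, which is open because `ρ₂` is an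
    -- open embedding.
    have : Sigma.mk k ⁻¹' (Quotient.mk S ⁻¹' (θ j '' O)) =
        fn I (A.ρ₂ j k) '' (fn I (A.ρ₁ j k) ⁻¹' O) := by
      ext y
      constructor
      · rintro ⟨x, hx, h⟩
        obtain ⟨z, rfl, rfl⟩ := (heq j k x y).1 h
        exact ⟨z, hx, rfl⟩
      · rintro ⟨z, hz, rfl⟩
        exact ⟨_, hz, (heq _ _ _ _).2 ⟨z, rfl, rfl⟩⟩
    change IsOpen (Sigma.mk k ⁻¹' (Quotient.mk S ⁻¹' (θ j '' O)))
    rw [this]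
    exact (hA.sub₂ j k : opens I _).isOpenMap _ (hO.preimage (fn_diffuse I _).continuous)
  have hθ : ∀ j, IsOpenEmbedding (θ j) := fun j =>
    .of_continuous_injective_isOpenMap (continuous_quotient_mk'.comp continuous_sigmaMk)
      (fun x y hxy => by
        obtain ⟨z, rfl, rfl⟩ := (heq _ _ _ _).1 hxy
        rw [hI.canopy_ρ₁_eq_ρ₂ hA]) (hopen j)
  have hconn : LocallyConnectedSpace (Quotient S) := by
    rw [locallyConnectedSpace_iff_subsets_isOpen_isConnected]
    intro x U hU
    obtain ⟨j, y, rfl⟩ := hsurj x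
    obtain ⟨V, hV, h1, h2, h3⟩ := locallyConnectedSpace_iff_subsets_isOpen_isConnected.1
      (inferInstance : LocallyConnectedSpace (pts I (A.obj j))) y _
      ((hθ j).continuous.continuousAt hU)
    exact ⟨θ j '' V, Set.image_subset_iff.2 hV, hopen j V h1, ⟨y, h2, rfl⟩,
      h3.image _ (hθ j).continuous.continuousOn⟩
  exact ⟨⟨Quotient S⟩, θ, hθ, hsurj, heq⟩

end Glue

/-- If spaces which are covered by open subspaces from `C` come from `C`, then the
pseudogeometric topology on `C` is a global structure. -/
theorem isGlobalStructure (hI : HasOpens I)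
    (h : ∀ X : Gen.{u}, (∀ x : X.carrier, ∃ (U : C) (i : pts I U → X.carrier),
      IsOpenEmbedding i ∧ x ∈ Set.range i) → ∃ X' : C, I.obj X' = X) :
    CatTopology.IsGlobalStructure.{u} (pseudogeometric (I ⋙ Gen.toTop)) where
  localStructure := hI.isLocalStructure
  closed := by
    intro J A hA
    obtain ⟨X, θ, h1, h2, h3⟩ := hI.exists_glue hA
    -- An equality of spaces, not merely an isomorphism, lets the glued maps `θ` be used unchanged.
    obtain ⟨X, rfl⟩ := h X fun x => by
      obtain ⟨j, y, hy⟩ := h2 x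
      exact ⟨A.obj j, θ j, h1 j, y, hy⟩
    choose φ hφ using fun j => hI.exists_hom (θ j) (IsDiffuse.of_isOpenEmbedding (h1 j))
    have h4 : ∀ j, opens I (φ j) := fun j => by
      unfold opens
      rw [hφ]
      exact h1 j
    refine ⟨X, φ, h4, ofArrows_mem_cov_iff.2 ⟨hA.nonempty, h4, fun x => ?_⟩, fun j k => ?_⟩
    · simpa only [hφ] using h2 x
    · refine hI.isPullback_of (h4 k) (hI.fn_injective (funext fun z => ?_)) (hA.sub₁ j k) ?_
      · rw [fn_comp, fn_comp, hφ, hφ]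
        exact (h3 _ _ _ _).2 ⟨z, rfl, rfl⟩
      · ext x
        simp only [hφ, Set.mem_range, Set.mem_preimage]
        constructor
        · rintro ⟨z, rfl⟩
          exact ⟨_, ((h3 _ _ _ _).2 ⟨z, rfl, rfl⟩).symm⟩
        · rintro ⟨y, hy⟩
          obtain ⟨z, hz, -⟩ := (h3 _ _ _ _).1 hy.symm
          exact ⟨z, hz⟩

end HasOpens

theorem isGlobalStructure_topology : CatTopology.IsGlobalStructure.{u} Gen.topology.{u} :=
  hasOpens_id.isGlobalStructure fun X _ => ⟨X, rfl⟩

end Gen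

theorem HGen.isLocalStructure_topology :
    CatTopology.IsLocalStructure.{u} HGen.topology.{u} :=
  Gen.hasOpens_hausdorff.isLocalStructure

/-- An open embedding carries a Hausdorff open subset of a piece to a Hausdorff open subset of the
glued space. -/
theorem HGenPlus.isGlobalStructure_topology :
    CatTopology.IsGlobalStructure.{u} HGenPlus.topology.{u} := by
  refine Gen.hasOpens_locallyHausdorff.isGlobalStructure fun X hX => ?_
  suffices h : IsLocallyHausdorff X.carrier from ⟨⟨X, h⟩, rfl⟩
  refine ⟨{V | IsOpen V ∧ T2Space V}, fun V hV => hV, Set.eq_univ_of_forall fun x => ?_⟩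
  obtain ⟨U, i, hi, y, rfl⟩ := hX x
  obtain ⟨𝒱, h1, h2⟩ := U.property
  obtain ⟨V, hV, hy⟩ := h2.symm.subset (Set.mem_univ y)
  have : T2Space V := (h1 V hV).2
  refine ⟨i '' V, ⟨hi.isOpenMap _ (h1 V hV).1, ?_⟩, y, hy, rfl⟩
  exact (hi.isEmbedding.homeomorphImage V).symm.isEmbedding.t2Space

/-! ### Covers in an intrinsic topology -/

namespace CatTopology

section

variable {E : Type w} [Category.{v} E] {L : CatTopology E}

theorem IsTopology.exists_isPullback (hL : L.IsTopology) {U X Y : E} (f : X ⟶ Y) {b : U ⟶ Y}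
    (hb : L.Sub b) : ∃ (P : E) (p : P ⟶ X) (q : P ⟶ U), IsPullback p q f b :=
  have := hL.sub.pullbackBase b f hb
  ⟨_, _, _, IsPullback.of_hasPullback f b⟩

theorem IsTopology.sub_of_mem_cov (hL : L.IsTopology) {J : Type u} {X : E} {U : J → E}
    {θ : ∀ j, U j ⟶ X} (hθ : Presieve.ofArrows U θ ∈ L.Cov X) (j : J) : L.Sub (θ j) :=
  hL.cov_isSubCone _ hθ _ ⟨j⟩

/-- Pullbacks of indexed covers are covers. -/
theorem IsTopology.ofArrows_pullback (hL : L.IsTopology) {J : Type u} {X T : E} {U V : J → E}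
    {θ : ∀ j, U j ⟶ X} (hθ : Presieve.ofArrows U θ ∈ L.Cov X) (f : T ⟶ X) (t : ∀ j, V j ⟶ T)
    (r : ∀ j, V j ⟶ U j) (h : ∀ j, IsPullback (t j) (r j) f (θ j)) :
    Presieve.ofArrows V t ∈ L.Cov T := by
  refine hL.cov_pullback f _ _ hθ ?_ ?_
  · rintro _ _ ⟨j⟩
    exact ⟨_, t j, r j, ⟨j⟩, h j⟩
  · rintro _ _ ⟨j⟩
    exact ⟨_, θ j, r j, ⟨j⟩, h j⟩

/-- Compatible morphisms on the members of a cover can be amalgamated. -/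
theorem IsIntrinsic.exists_amalgamation (hi : IsIntrinsic.{u} L) {J : Type u} {X Y : E}
    {U : J → E} {θ : ∀ j, U j ⟶ X} (hθ : Presieve.ofArrows U θ ∈ L.Cov X) {P : J → J → E}
    {p : ∀ j k, P j k ⟶ U j} {q : ∀ j k, P j k ⟶ U k}
    (h : ∀ j k, IsPullback (p j k) (q j k) (θ j) (θ k)) (f : ∀ j, U j ⟶ Y)
    (hf : ∀ j k, p j k ≫ f j = q j k ≫ f k) : ∃! g : X ⟶ Y, ∀ j, θ j ≫ g = f j :=
  (hi ⟨U, P, p, q⟩ θ hθ h).2 f hf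

/-- Covers are jointly epimorphic. -/
theorem IsIntrinsic.hom_ext (hi : IsIntrinsic.{u} L) (hL : L.IsTopology) {J : Type u} {X Y : E}
    {U : J → E} {θ : ∀ j, U j ⟶ X} (hθ : Presieve.ofArrows U θ ∈ L.Cov X) {f g : X ⟶ Y}
    (h : ∀ j, θ j ≫ f = θ j ≫ g) : f = g := by
  choose P p q hP using fun j k => hL.exists_isPullback (θ j) (hL.sub_of_mem_cov hθ k)
  exact (hi.exists_amalgamation hθ hP (fun j => θ j ≫ g)
    (fun j k => by rw [← Category.assoc, (hP j k).w, Category.assoc])).unique h fun _ => rfl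

/-- A commutative square is a fibered product if it is so locally on one of its factors. -/
theorem IsIntrinsic.isPullback_of_cover (hi : IsIntrinsic.{u} L) (hL : L.IsTopology) {J : Type u}
    {P U X Y : E} {p : P ⟶ X} {q : P ⟶ U} {f : X ⟶ Y} {b : U ⟶ Y} (w : p ≫ f = q ≫ b)
    {X' : J → E} {s : ∀ j, X' j ⟶ X} (hs : Presieve.ofArrows X' s ∈ L.Cov X)
    {P' : J → E} {p' : ∀ j, P' j ⟶ X' j} {r : ∀ j, P' j ⟶ P}
    (h₁ : ∀ j, IsPullback (p' j) (r j) (s j) p)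
    (h₂ : ∀ j, IsPullback (p' j) (r j ≫ q) (s j ≫ f) b) : IsPullback p q f b := by
  -- Over `X' j` the object `P` restricts to a known fibered product, so two morphisms with equal
  -- projections agree on the induced cover of `T`.
  have huniq : ∀ {T : E} (a a' : T ⟶ P), a ≫ p = a' ≫ p → a ≫ q = a' ≫ q → a = a' := by
    intro T a a' hp hq
    choose V t x hV using fun j => hL.exists_isPullback (a ≫ p) (hL.sub_of_mem_cov hs j)
    refine hi.hom_ext hL (hL.ofArrows_pullback hs _ t x hV) fun j => ?_
    have e : x j ≫ s j = (t j ≫ a) ≫ p := by rw [← (hV j).w, Category.assoc]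
    have e' : x j ≫ s j = (t j ≫ a') ≫ p := by rw [e, Category.assoc, hp, Category.assoc]
    have : (h₁ j).lift _ _ e = (h₁ j).lift _ _ e' := by
      refine (h₂ j).hom_ext (by simp) ?_
      rw [← Category.assoc, ← Category.assoc, IsPullback.lift_snd, IsPullback.lift_snd,
        Category.assoc, hq, Category.assoc]
    rw [← (h₁ j).lift_snd _ _ e, this, IsPullback.lift_snd]
  -- The lifts over the members `X' j` agree on overlaps by `huniq`, so they amalgamate.
  have hlift : ∀ c : PullbackCone f b, ∃ l : c.pt ⟶ P, l ≫ p = c.fst ∧ l ≫ q = c.snd := by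
    intro c
    choose V t x hV using fun j => hL.exists_isPullback c.fst (hL.sub_of_mem_cov hs j)
    have ht := hL.ofArrows_pullback hs _ t x hV
    choose V₂ d d' hd using fun j k => hL.exists_isPullback (t j) (hL.sub_of_mem_cov ht k)
    have e : ∀ j, x j ≫ s j ≫ f = (t j ≫ c.snd) ≫ b := fun j => by
      rw [← Category.assoc, ← (hV j).w, Category.assoc, c.condition, Category.assoc]
    have hp : ∀ j, ((h₂ j).lift _ _ (e j) ≫ r j) ≫ p = t j ≫ c.fst := fun j => by
      rw [Category.assoc, ← (h₁ j).w, ← Category.assoc, IsPullback.lift_fst, (hV j).w]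
    have hq : ∀ j, ((h₂ j).lift _ _ (e j) ≫ r j) ≫ q = t j ≫ c.snd := fun j => by
      rw [Category.assoc, IsPullback.lift_snd]
    obtain ⟨l, hl, -⟩ := hi.exists_amalgamation ht hd (fun j => (h₂ j).lift _ _ (e j) ≫ r j)
      (fun j k => huniq _ _
        (by rw [Category.assoc (d j k), Category.assoc (d' j k), hp, hp, ← Category.assoc,
          ← Category.assoc, (hd j k).w])
        (by rw [Category.assoc (d j k), Category.assoc (d' j k), hq, hq, ← Category.assoc,
          ← Category.assoc, (hd j k).w]))
    refine ⟨l, hi.hom_ext hL ht fun j => ?_, hi.hom_ext hL ht fun j => ?_⟩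
    · rw [← Category.assoc, hl, hp]
    · rw [← Category.assoc, hl, hq]
  choose l hl hl' using hlift
  exact ⟨⟨w⟩, ⟨PullbackCone.IsLimit.mk w l hl hl' fun c m h h' =>
    huniq _ _ (h.trans (hl c).symm) (h'.trans (hl' c).symm)⟩⟩

/-- In a flush topology a cone of formal subsets is a cover if it is refined by covers of the
members of a cover. -/
theorem IsFlush.mem_cov_of_local (hf : L.IsFlush) (hL : L.IsTopology) {X : E} {R S : Presieve X}
    (hR : R ∈ L.Cov X) (hS : L.IsSubCone S)
    (h : ∀ ⦃Y : E⦄ (r : Y ⟶ X), R r → ∃ S' ∈ L.Cov Y, ∀ ⦃Z : E⦄ (s' : Z ⟶ Y), S' s' →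
      ∃ (W : E) (s : W ⟶ X) (g : Z ⟶ W), S s ∧ g ≫ s = s' ≫ r) : S ∈ L.Cov X := by
  choose S' hS' hfac using h
  refine hf _ S (hL.cov_bind R (fun Y s hs => S' s hs) hR fun Y s hs => hS' s hs) hS ?_
  rintro Z _ ⟨Y, t, s, hs, ht, rfl⟩
  exact hfac s hs t ht

end

end CatTopology

/-! ### Images of canopies -/

section

variable {C : Type w₁} [Category.{v₁} C] {D : Type w₂} [Category.{v₂} D] {J : Type u}

/-- The image of a graph under a functor. -/
abbrev CanopyGraph.map (A : CanopyGraph C J) (F : C ⥤ D) : CanopyGraph D J where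
  obj j := F.obj (A.obj j)
  obj₂ j k := F.obj (A.obj₂ j k)
  ρ₁ j k := F.map (A.ρ₁ j k)
  ρ₂ j k := F.map (A.ρ₂ j k)

variable {T : CatTopology C} {K : CatTopology D}

theorem IsContinuousFunctor.ofArrows_mem_cov {F : C ⥤ D} (hF : IsContinuousFunctor T K F) {X : C}
    {U : J → C} {θ : ∀ j, U j ⟶ X} (hθ : Presieve.ofArrows U θ ∈ T.Cov X) :
    Presieve.ofArrows (fun j => F.obj (U j)) (fun j => F.map (θ j)) ∈ K.Cov (F.obj X) := by
  rw [← Presieve.map_ofArrows]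
  exact hF.map_cov _ hθ

theorem IsContinuousFunctor.comp {E : Type w} [Category.{v} E] {L : CatTopology E} {F : C ⥤ D}
    {G : D ⥤ E} (hF : IsContinuousFunctor T K F) (hG : IsContinuousFunctor K L G) :
    IsContinuousFunctor T L (F ⋙ G) where
  map_sub X Y f hf := hG.map_sub _ (hF.map_sub _ hf)
  map_cov X S hS := by
    have h := hG.map_cov _ (hF.map_cov _ hS)
    have e : Presieve.map (F ⋙ G) S = Presieve.map G (Presieve.map F S) := by
      refine le_antisymm ?_ ?_
      · rintro _ _ ⟨h⟩
        exact ⟨⟨h⟩⟩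
      · rintro _ _ ⟨⟨h⟩⟩
        exact ⟨h⟩
    rw [e]
    exact h
  map_pullback P U X Y p q f b hb h := hG.map_pullback _ _ _ _ (hF.map_sub _ hb)
    (hF.map_pullback _ _ _ _ hb h)

/-- For covers, the image of `S` under `F`, followed by the isomorphism `e`, factors memberwise
through its image under `F'`; flushness does the rest. -/
theorem IsContinuousFunctor.of_iso {F F' : C ⥤ D} (hF : IsContinuousFunctor T K F) (e : F ≅ F')
    (hK : K.IsTopology) (hK' : K.IsFlush) (hT : T.IsTopology) : IsContinuousFunctor T K F' := by
  have hsub : ∀ ⦃X Y : C⦄ (f : X ⟶ Y), T.Sub f → K.Sub (F'.map f) := fun X Y f hf => by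
    rw [← NatIso.naturality_1 e f]
    exact hK.sub.comp _ _ (hK.sub.of_isIso _ inferInstance)
      (hK.sub.comp _ _ (hF.map_sub _ hf) (hK.sub.of_isIso _ inferInstance))
  refine ⟨hsub, fun X S hS => ?_, fun P U X Y p q f b hb h => ?_⟩
  · refine hK'.mem_cov_of_local hK (hK.cov_iso (e.hom.app X) inferInstance) ?_ ?_
    · rintro _ _ ⟨hf⟩
      exact hsub _ (hT.cov_isSubCone S hS _ hf)
    · rintro _ _ ⟨⟩
      refine ⟨_, hF.map_cov S hS, ?_⟩
      rintro _ _ ⟨hf⟩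
      exact ⟨_, _, e.hom.app _, ⟨hf⟩, (e.hom.naturality _).symm⟩
  · exact (hF.map_pullback p q f b hb h).of_iso (e.app _) (e.app _) (e.app _) (e.app _)
      (by simp) (by simp) (by simp) (by simp)

/-- Continuous functors preserve canopies if formal subsets are monomorphisms in the source. -/
theorem IsContinuousFunctor.map_isCanopy {F : C ⥤ D} (hF : IsContinuousFunctor T K F)
    (hT : T.IsTopology) (hmono : ∀ ⦃X Y : C⦄ (f : X ⟶ Y), T.Sub f → Mono f)
    {A : CanopyGraph C J} (hA : A.IsCanopy T) : (A.map F).IsCanopy K where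
  nonempty := hA.nonempty
  sub₁ j k := hF.map_sub _ (hA.sub₁ j k)
  sub₂ j k := hF.map_sub _ (hA.sub₂ j k)
  jointlyMono j k Z f g h _ := by
    have := hmono _ (hA.sub₁ j k)
    -- Being a monomorphism means having identities as kernel pair. This is a pullback along a
    -- formal subset, so `F` preserves it, and `ρ₁` alone gives joint monicity.
    have hk := hF.map_pullback _ _ _ _ (hA.sub₁ j k) (IsKernelPair.id_of_mono (A.ρ₁ j k))
    rw [F.map_id] at hk
    have h1 := hk.lift_fst f g h
    have h2 := hk.lift_snd f g h
    exact h1.symm.trans h2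
  refl j := by
    obtain ⟨δ, h1, h2⟩ := hA.refl j
    exact ⟨F.map δ, by rw [← F.map_comp, h1, F.map_id], by rw [← F.map_comp, h2, F.map_id]⟩
  symm j k := by
    obtain ⟨σ, h1, h2⟩ := hA.symm j k
    exact ⟨F.map σ, by rw [← F.map_comp, h1], by rw [← F.map_comp, h2]⟩
  trans i j k P p q h := by
    obtain ⟨P₀, p₀, q₀, h₀⟩ := hT.exists_isPullback (A.ρ₂ i j) (hA.sub₁ j k)
    obtain ⟨ω, h1, h2⟩ := hA.trans i j k p₀ q₀ h₀
    have h₀' := hF.map_pullback _ _ _ _ (hA.sub₁ j k) h₀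
    refine ⟨h₀'.lift p q h.w ≫ F.map ω, ?_, ?_⟩
    · rw [Category.assoc, ← F.map_comp, h1, F.map_comp, ← Category.assoc, h₀'.lift_fst]
    · rw [Category.assoc, ← F.map_comp, h2, F.map_comp, ← Category.assoc, h₀'.lift_snd]

/-- A graph whose image is a canopy of a cone is a canopy. -/
theorem CanopyGraph.isCanopy_of_map (F : C ⥤ D) [F.Full] [F.Faithful] [Nonempty J]
    {A : CanopyGraph C J} (h₁ : ∀ j k, T.Sub (A.ρ₁ j k)) (h₂ : ∀ j k, T.Sub (A.ρ₂ j k)) {X : D}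
    {θ : ∀ j, F.obj (A.obj j) ⟶ X} (hA : (A.map F).IsCanopyOf θ) : A.IsCanopy T := by
  have hA' : ∀ j k, IsPullback (F.map (A.ρ₁ j k)) (F.map (A.ρ₂ j k)) (θ j) (θ k) := hA
  have lift : ∀ j k {V : C} (a : V ⟶ A.obj j) (b : V ⟶ A.obj k),
      F.map a ≫ θ j = F.map b ≫ θ k → ∃ l : V ⟶ A.obj₂ j k, l ≫ A.ρ₁ j k = a ∧ l ≫ A.ρ₂ j k = b :=
    fun j k V a b h => ⟨F.preimage ((hA' j k).lift _ _ h),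
      F.map_injective (by simp), F.map_injective (by simp)⟩
  refine ⟨inferInstance, h₁, h₂, fun j k Z f g h h' => F.map_injective ((hA' j k).hom_ext ?_ ?_),
    fun j => lift j j _ _ rfl, fun j k => lift k j _ _ (hA' j k).w.symm,
    fun i j k P p q h => lift i k _ _ ?_⟩
  · rw [← F.map_comp, h, F.map_comp]
  · rw [← F.map_comp, h', F.map_comp]
  · rw [F.map_comp, F.map_comp, Category.assoc, Category.assoc, (hA' i j).w, ← (hA' j k).w,
      ← Category.assoc, ← F.map_comp, h.w, F.map_comp, Category.assoc]

end

section

variable {C : Type w₁} [Category.{v₁} C] {E : Type w} [Category.{v} E] {J : Type u}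

theorem CanopyGraph.IsAffinization.of_natIso {L : CatTopology E} (hL : L.IsTopology)
    (hL' : L.IsFlush) {A : CanopyGraph C J} {G G' : C ⥤ E} (e : G ≅ G') {X X' : E} (i : X ≅ X')
    {φ : ∀ j, G.obj (A.obj j) ⟶ X} {φ' : ∀ j, G'.obj (A.obj j) ⟶ X'}
    (w : ∀ j, φ j ≫ i.hom = e.hom.app (A.obj j) ≫ φ' j) (h : (A.map G).IsAffinization L φ) :
    (A.map G').IsAffinization L φ' := by
  have hsub : ∀ j, L.Sub (φ' j) := fun j => by
    have : φ' j = e.inv.app _ ≫ φ j ≫ i.hom := by rw [w]; simp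
    rw [this]
    exact hL.sub.comp _ _ (hL.sub.of_isIso _ inferInstance)
      (hL.sub.comp _ _ (h.sub j) (hL.sub.of_isIso _ inferInstance))
  refine ⟨hsub, hL'.mem_cov_of_local hL (hL.cov_iso i.hom inferInstance) ?_ ?_, fun j k => ?_⟩
  · rintro _ _ ⟨j⟩
    exact hsub j
  · rintro _ _ ⟨⟩
    refine ⟨_, h.cov, ?_⟩
    rintro _ _ ⟨j⟩
    exact ⟨_, φ' j, e.hom.app _, ⟨j⟩, (w j).symm⟩
  · exact (h.canopyOf j k).of_iso (e.app _) (e.app _) (e.app _) i (by simp) (by simp)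
      (by simpa using w j) (by simpa using w k)

end

namespace Gen

/-! ### Atlases -/

section

variable {C : Type w₁} [Category.{v₁} C] {D : Type w₂} [Category.{v₂} D] {F : C ⥤ D}
  {I : D ⥤ Gen.{u}} {J : Type u}

variable (F I) in
/-- A complete atlas of `X`: all open embeddings into `X` of objects of `C`, up to
isomorphism. -/
structure IsAtlas {X : D} (A : CanopyGraph C J) (θ : ∀ j, F.obj (A.obj j) ⟶ X) : Prop where
  opens : ∀ j, opens I (θ j)
  cov : Presieve.ofArrows (fun j => F.obj (A.obj j)) θ ∈ (pseudogeometric (I ⋙ Gen.toTop)).Cov X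
  isPullback : ∀ j k, IsPullback (F.map (A.ρ₁ j k)) (F.map (A.ρ₂ j k)) (θ j) (θ k)
  complete : ∀ ⦃U : C⦄ (u : F.obj U ⟶ X), Gen.opens I u →
    ∃ (j : J) (e : U ≅ A.obj j), F.map e.hom ≫ θ j = u

variable (F I) in
/-- `C` is a full subcategory of `D` which is closed under open subspaces and by which all
objects of `D` are covered. -/
structure IsBasis : Prop where
  full : F.Full
  faithful : F.Faithful
  source : HasOpens (F ⋙ I)
  target : HasOpens I
  covered : ∀ Y : D, ∃ (J : Type u) (U : J → C) (θ : ∀ j, F.obj (U j) ⟶ Y),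
    Presieve.ofArrows (fun j => F.obj (U j)) θ ∈ (pseudogeometric (I ⋙ Gen.toTop)).Cov Y

namespace IsBasis

/-- The fibered product is an open subspace of `U`, and the basis is closed under open subspaces. -/
theorem exists_isPullback_obj (h : IsBasis F I) {U : C} {B X : D} (u : F.obj U ⟶ X) {b : B ⟶ X}
    (hb : opens I b) : ∃ (V : C) (p : V ⟶ U) (q : F.obj V ⟶ B), opens (F ⋙ I) p ∧
      IsPullback (F.map p) q u b := by
  obtain ⟨P, p, q, hP, hp, hr⟩ := h.target.exists_isPullback u hb
  obtain ⟨V, i, hi, hr'⟩ := h.source.exists_restrict U (Set.range (fn I p)) hp.isOpen_range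
  obtain ⟨l, hl⟩ := h.target.exists_lift hb (F.map i ≫ u) (by
    rintro _ ⟨x, rfl⟩
    rw [fn_comp]
    exact hr.subset (hr'.subset ⟨x, rfl⟩))
  exact ⟨V, i, l, hi, h.target.isPullback_of hb hl.symm hi (hr'.trans hr)⟩

theorem exists_isPullback (h : IsBasis F I) {U W : C} {X : D} (u : F.obj U ⟶ X)
    {b : F.obj W ⟶ X} (hb : opens I b) :
    ∃ (V : C) (p : V ⟶ U) (q : V ⟶ W), opens (F ⋙ I) p ∧ IsPullback (F.map p) (F.map q) u b := by
  have := h.full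
  obtain ⟨V, p, q, hp, hV⟩ := h.exists_isPullback_obj u hb
  exact ⟨V, p, F.preimage q, hp, by rwa [F.map_preimage]⟩

/-- Smallness of the topology bounds the size: from a set of representatives of the open embeddings
into `X`, those whose source is isomorphic to an object of the basis are kept. -/
theorem exists_isAtlas (h : IsBasis F I) (X : D) :
    ∃ (J : Type u) (A : CanopyGraph C J) (θ : ∀ j, F.obj (A.obj j) ⟶ X), IsAtlas F I A θ := by
  have := h.full
  have := h.faithful
  obtain ⟨J, U, θ, hθ, hc⟩ := h.target.isSmall X
  choose V e using fun j : {j : J // ∃ V : C, Nonempty (F.obj V ≅ U j)} => j.2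
  let φ : ∀ j, F.obj (V j) ⟶ X := fun j => (e j).some.hom ≫ θ j
  have hφ : ∀ j, opens I (φ j) := fun j =>
    HasOpens.opens_comp (HasOpens.opens_of_isIso _) (hθ j)
  have hcomp : ∀ ⦃W : C⦄ (u : F.obj W ⟶ X), opens I u →
      ∃ (j : _) (e : W ≅ V j), F.map e.hom ≫ φ j = u := by
    intro W u hu
    obtain ⟨j, f, hf⟩ := hc u hu
    let j' : {j : J // ∃ V : C, Nonempty (F.obj V ≅ U j)} := ⟨j, W, ⟨f⟩⟩
    refine ⟨j', F.preimageIso (f ≪≫ (e j').some.symm), ?_⟩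
    rw [F.preimageIso_hom, F.map_preimage]
    simpa [φ] using hf
  choose P p q hp hP using fun j k => h.exists_isPullback (φ j) (hφ k)
  refine ⟨_, ⟨V, P, p, q⟩, φ, hφ, HasOpens.ofArrows_mem_cov_iff.2 ⟨?_, hφ, fun x => ?_⟩, hP, hcomp⟩
  · obtain ⟨K, W, ψ, hψ⟩ := h.covered X
    rw [HasOpens.ofArrows_mem_cov_iff] at hψ
    obtain ⟨⟨k⟩, h2, -⟩ := hψ
    exact ⟨(hcomp _ (h2 k)).choose⟩
  · obtain ⟨K, W, ψ, hψ⟩ := h.covered X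
    rw [HasOpens.ofArrows_mem_cov_iff] at hψ
    obtain ⟨-, h2, h3⟩ := hψ
    obtain ⟨k, y, rfl⟩ := h3 x
    obtain ⟨j, e, he⟩ := hcomp _ (h2 k)
    exact ⟨j, fn I (F.map e.hom) y, by rw [← fn_comp, he]⟩

variable {X : D} {A : CanopyGraph C J} {θ : ∀ j, F.obj (A.obj j) ⟶ X}

theorem isCanopy (h : IsBasis F I) (hA : IsAtlas F I A θ) :
    A.IsCanopy (pseudogeometric ((F ⋙ I) ⋙ Gen.toTop)) := by
  have := h.full
  have := h.faithful
  have := (HasOpens.ofArrows_mem_cov_iff.1 hA.cov).1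
  refine CanopyGraph.isCanopy_of_map F (fun j k => ?_) (fun j k => ?_) hA.isPullback
  · exact (h.target.opens_range_of_isPullback (hA.opens k) (hA.isPullback j k)).1
  · exact (h.target.opens_range_of_isPullback (hA.opens j) (hA.isPullback j k).flip).1

/-- The pullback of an atlas to an object of `C`. -/
theorem exists_pullback_atlas (h : IsBasis F I) (hA : IsAtlas F I A θ) {U : C}
    (u : F.obj U ⟶ X) : ∃ (V : J → C) (a : ∀ j, V j ⟶ U) (b : ∀ j, V j ⟶ A.obj j),
      (∀ j, opens (F ⋙ I) (a j)) ∧ (∀ j, IsPullback (F.map (a j)) (F.map (b j)) u (θ j)) ∧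
      Presieve.ofArrows V a ∈ (pseudogeometric ((F ⋙ I) ⋙ Gen.toTop)).Cov U := by
  choose V a b ha hV using fun j => h.exists_isPullback u (hA.opens j)
  obtain ⟨h1, h2, h3⟩ := HasOpens.ofArrows_mem_cov_iff.1 hA.cov
  refine ⟨V, a, b, ha, hV, HasOpens.ofArrows_mem_cov_iff.2 ⟨h1, ha, fun x => ?_⟩⟩
  obtain ⟨j, y, hy⟩ := h3 (fn I u x)
  obtain ⟨z, hz, -⟩ := h.target.exists_pt_of_isPullback (h2 j) (hV j) hy.symm
  exact ⟨j, z, hz⟩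

/-! ### Extension of continuous functors along a basis -/

variable {E : Type w} [Category.{v} E] {L : CatTopology E} {G : C ⥤ E} {Z : E}
  {φ : ∀ j, G.obj (A.obj j) ⟶ Z}

/-- The pair `(a, b)` factors through `A[j,k]`, where the legs `φ` agree by assumption. -/
theorem comp_eq_of_isCanopyOf (h : IsBasis F I) (hA : IsAtlas F I A θ)
    (hφ : (A.map G).IsCanopyOf φ) {V : C} {j k : J} (a : V ⟶ A.obj j) (b : V ⟶ A.obj k)
    (w : F.map a ≫ θ j = F.map b ≫ θ k) : G.map a ≫ φ j = G.map b ≫ φ k := by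
  have := h.full
  have := h.faithful
  let l := F.preimage ((hA.isPullback j k).lift _ _ w)
  have h1 : l ≫ A.ρ₁ j k = a := F.map_injective (by simp [l])
  have h2 : l ≫ A.ρ₂ j k = b := F.map_injective (by simp [l])
  have h3 : G.map (A.ρ₁ j k) ≫ φ j = G.map (A.ρ₂ j k) ≫ φ k := (hφ j k).w
  rw [← h1, ← h2, G.map_comp, G.map_comp, Category.assoc, h3, Category.assoc]

/-- The leg at an arbitrary `u`, not necessarily open, is amalgamated from the pullback of the atlas
to `U`. Characterizing it by all local factorizations through charts makes it independent of that
cover, so that naturality follows from uniqueness. -/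
theorem existsUnique_leg (h : IsBasis F I)
    (hG : IsContinuousFunctor (pseudogeometric ((F ⋙ I) ⋙ Gen.toTop)) L G) (hL : L.IsTopology)
    (hi : CatTopology.IsIntrinsic.{u} L) (hA : IsAtlas F I A θ) (hφ : (A.map G).IsCanopyOf φ)
    {U : C} (u : F.obj U ⟶ X) :
    ∃! c : G.obj U ⟶ Z, ∀ ⦃V : C⦄ (a : V ⟶ U) (j : J) (b : V ⟶ A.obj j),
      F.map a ≫ u = F.map b ≫ θ j → G.map a ≫ c = G.map b ≫ φ j := by
  have := h.full
  have := h.faithful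
  obtain ⟨V, a, b, ha, hV, hcov⟩ := h.exists_pullback_atlas hA u
  choose W d d' hd using fun j k =>
    h.source.isTopology.exists_isPullback (a j) (b := a k) (ha k)
  have hcov' := hG.ofArrows_mem_cov hcov
  obtain ⟨c, hc, -⟩ := hi.exists_amalgamation hcov'
    (fun j k => hG.map_pullback _ _ _ _ (ha k) (hd j k)) (fun j => G.map (b j) ≫ φ j)
    (fun j k => by
      rw [← Category.assoc, ← Category.assoc, ← G.map_comp, ← G.map_comp]
      refine h.comp_eq_of_isCanopyOf hA hφ _ _ ?_
      rw [F.map_comp, F.map_comp, Category.assoc, Category.assoc, ← (hV j).w, ← (hV k).w,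
        ← Category.assoc, ← Category.assoc, ← F.map_comp, ← F.map_comp, (hd j k).w])
  refine ⟨c, fun T t k s w => ?_, fun c' hc' => ?_⟩
  · let m := F.preimage ((hV k).lift _ _ w)
    have h1 : m ≫ a k = t := F.map_injective (by simp [m])
    have h2 : m ≫ b k = s := F.map_injective (by simp [m])
    rw [← h1, ← h2, G.map_comp, G.map_comp, Category.assoc, Category.assoc, hc]
  · exact hi.hom_ext hL hcov' fun j => by rw [hc, hc' _ _ _ (hV j).w]

theorem exists_cocone (h : IsBasis F I)
    (hG : IsContinuousFunctor (pseudogeometric ((F ⋙ I) ⋙ Gen.toTop)) L G) (hL : L.IsTopology)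
    (hi : CatTopology.IsIntrinsic.{u} L) (hA : IsAtlas F I A θ) (hφ : (A.map G).IsCanopyOf φ) :
    ∃ ι : CostructuredArrow.proj F X ⋙ G ⟶ (Functor.const _).obj Z,
      ∀ j, ι.app (CostructuredArrow.mk (θ j)) = φ j := by
  choose c hc hc' using fun (u : CostructuredArrow F X) =>
    h.existsUnique_leg hG hL hi hA hφ u.hom
  refine ⟨⟨c, fun u u' f => ?_⟩, fun j => ?_⟩
  · refine (hc' u (G.map f.left ≫ c u') fun V a j b w => ?_).trans (Category.comp_id _).symm
    rw [← Category.assoc, ← G.map_comp]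
    refine hc u' _ j b ?_
    rw [F.map_comp, Category.assoc, CostructuredArrow.w, w]
  · exact (hc' (CostructuredArrow.mk (θ j)) (φ j)
      fun V a k b w => h.comp_eq_of_isCanopyOf hA hφ a b w).symm

theorem cocone_comp {s : Cocone (CostructuredArrow.proj F X ⋙ G)} {U V : C} (a : V ⟶ U)
    (u : F.obj U ⟶ X) : G.map a ≫ s.ι.app (CostructuredArrow.mk u) =
      s.ι.app (CostructuredArrow.mk (F.map a ≫ u)) :=
  s.w (CostructuredArrow.homMk a : CostructuredArrow.mk (F.map a ≫ u) ⟶ CostructuredArrow.mk u)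

/-- The chart legs are a cover with canopy `A.map G`, so they alone determine morphisms out of the
vertex. Compatibility with any other leg is checked on the pulled back atlas, where that leg factors
through charts. -/
theorem nonempty_isColimit (h : IsBasis F I)
    (hG : IsContinuousFunctor (pseudogeometric ((F ⋙ I) ⋙ Gen.toTop)) L G) (hL : L.IsTopology)
    (hi : CatTopology.IsIntrinsic.{u} L) (hA : IsAtlas F I A θ)
    (c : Cocone (CostructuredArrow.proj F X ⋙ G))
    (hc : (A.map G).IsAffinization L (fun j => c.ι.app (CostructuredArrow.mk (θ j)))) :
    Nonempty (IsColimit c) := by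
  have key : ∀ s : Cocone (CostructuredArrow.proj F X ⋙ G), ∃! g : c.pt ⟶ s.pt,
      ∀ j, c.ι.app (CostructuredArrow.mk (θ j)) ≫ g = s.ι.app (CostructuredArrow.mk (θ j)) :=
    fun s => hi.exists_amalgamation hc.cov hc.canopyOf _ fun j k => by
      refine (cocone_comp (s := s) (A.ρ₁ j k) (θ j)).trans (.trans ?_
        (cocone_comp (s := s) (A.ρ₂ j k) (θ k)).symm)
      rw [(hA.isPullback j k).w]
  choose g hg hg' using key
  refine ⟨⟨g, fun s u => ?_, fun s m hm => hg' s m fun j => hm _⟩⟩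
  obtain ⟨V, a, b, ha, hV, hcov⟩ := h.exists_pullback_atlas hA u.hom
  refine hi.hom_ext hL (hG.ofArrows_mem_cov hcov) fun j => ?_
  have h1 : G.map (a j) ≫ c.ι.app u = _ := cocone_comp (s := c) (a j) u.hom
  have h2 : G.map (a j) ≫ s.ι.app u = _ := cocone_comp (s := s) (a j) u.hom
  have h3 : c.ι.app (CostructuredArrow.mk (F.map (a j) ≫ u.hom)) ≫ g s =
      s.ι.app (CostructuredArrow.mk (F.map (a j) ≫ u.hom)) := by
    rw [(hV j).w, ← cocone_comp, ← cocone_comp]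
    exact (Category.assoc _ _ _).trans (congrArg (G.map (b j) ≫ ·) (hg s j))
  exact (Category.assoc (G.map (a j)) (c.ι.app u) (g s)).symm.trans
    ((congrArg (· ≫ g s) h1).trans (h3.trans h2.symm))

/-- A continuous functor on `D` is the pointwise left Kan extension of its restriction to `C`. -/
theorem restrict_bijective (h : IsBasis F I)
    (hF : IsContinuousFunctor (pseudogeometric ((F ⋙ I) ⋙ Gen.toTop))
      (pseudogeometric (I ⋙ Gen.toTop)) F)
    (hL : L.IsTopology) (hi : CatTopology.IsIntrinsic.{u} L) {G₁ : D ⥤ E}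
    (hG₁ : IsContinuousFunctor (pseudogeometric (I ⋙ Gen.toTop)) L G₁) (G₂ : D ⥤ E) :
    Function.Bijective (fun α : G₁ ⟶ G₂ => Functor.whiskerLeft F α) := by
  let K := Functor.LeftExtension.mk G₁ (𝟙 (F ⋙ G₁))
  have hK : ∀ X, Nonempty (IsColimit (K.coconeAt X)) := by
    intro X
    obtain ⟨J, A, θ, hA⟩ := h.exists_isAtlas X
    refine h.nonempty_isColimit (hF.comp hG₁) hL hi hA _ ?_
    have e : (fun j => (K.coconeAt X).ι.app (CostructuredArrow.mk (θ j))) =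
        fun j => G₁.map (θ j) := funext fun j => Category.id_comp _
    rw [e]
    exact ⟨fun j => hG₁.map_sub _ (hA.opens j), hG₁.ofArrows_mem_cov hA.cov,
      fun j k => hG₁.map_pullback _ _ _ _ (hA.opens k) (hA.isPullback j k)⟩
  have : G₁.IsLeftKanExtension (𝟙 (F ⋙ G₁)) :=
    Functor.LeftExtension.IsPointwiseLeftKanExtension.isLeftKanExtension
      (E := K) (fun X => (hK X).some)
  -- The universal property of the Kan extension with identity unit holds against every functor
  -- `G₂`, continuous or not.
  have hb := (G₁.homEquivOfIsLeftKanExtension (L := F) (𝟙 (F ⋙ G₁)) G₂).bijective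
  convert hb using 1
  funext α
  exact (Category.id_comp _).symm

/-- Affinizations in the global structure supply the colimits for a pointwise left Kan extension
`H`, whose unit is invertible because `F` is fully faithful. The affinization of each atlas is
recorded, since the continuity of `H` rests on it. -/
theorem exists_extension_isAffinization (h : IsBasis F I)
    (hG : IsContinuousFunctor (pseudogeometric ((F ⋙ I) ⋙ Gen.toTop)) L G)
    (hL : CatTopology.IsGlobalStructure.{u} L) :
    ∃ (H : D ⥤ E) (_ : G ≅ F ⋙ H), ∀ X : D, ∃ (J : Type u) (A : CanopyGraph C J)
      (θ : ∀ j, F.obj (A.obj j) ⟶ X), IsAtlas F I A θ ∧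
        (A.map (F ⋙ H)).IsAffinization L (fun j => H.map (θ j)) := by
  have := h.full
  have := h.faithful
  have hT := hL.localStructure.topology
  have hi := hL.localStructure.intrinsic
  have key : ∀ X : D, ∃ (J : Type u) (A : CanopyGraph C J) (θ : ∀ j, F.obj (A.obj j) ⟶ X)
      (c : Cocone (CostructuredArrow.proj F X ⋙ G)) (_ : IsColimit c), IsAtlas F I A θ ∧
        (A.map G).IsAffinization L (fun j => c.ι.app (CostructuredArrow.mk (θ j))) := by
    intro X
    obtain ⟨J, A, θ, hA⟩ := h.exists_isAtlas X
    obtain ⟨Z, φ, hφ⟩ := hL.closed _ (hG.map_isCanopy h.source.isTopology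
      (fun _ _ f hf => h.source.mono hf) (h.isCanopy hA))
    obtain ⟨ι, hι⟩ := h.exists_cocone hG hT hi hA hφ.canopyOf
    have hc : (A.map G).IsAffinization L (fun j => ι.app (CostructuredArrow.mk (θ j))) := by
      rw [funext hι]
      exact hφ
    exact ⟨J, A, θ, ⟨Z, ι⟩, (h.nonempty_isColimit hG hT hi hA ⟨Z, ι⟩ hc).some, hA, hc⟩
  have : F.HasPointwiseLeftKanExtension G := fun X => by
    obtain ⟨J, A, θ, c, hc, -⟩ := key X
    exact ⟨⟨c, hc⟩⟩
  let α := F.pointwiseLeftKanExtensionUnit G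
  have hK := F.pointwiseLeftKanExtensionIsPointwiseLeftKanExtension G
  have hα : IsIso α := hK.isIso_hom
  refine ⟨F.pointwiseLeftKanExtension G, asIso α, fun X => ?_⟩
  obtain ⟨J, A, θ, c, hc, hA, hc'⟩ := key X
  refine ⟨J, A, θ, hA, CanopyGraph.IsAffinization.of_natIso hT hL.localStructure.flush (asIso α)
    (hc.coconePointUniqueUpToIso (hK X)) (fun j => ?_) hc'⟩
  exact hc.comp_coconePointUniqueUpToIso_hom (hK X) (CostructuredArrow.mk (θ j))

end IsBasis

end

end Gen

/-! ### Preservation of fibered products -/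

section

variable {D : Type w₂} [Category.{v₂} D] {E : Type w} [Category.{v} E]

/-- The functor `H` preserves the fibered products of `f` and `g`. -/
def CategoryTheory.Functor.PreservesFiberedProduct (H : D ⥤ E) {X Y Z : D} (f : X ⟶ Z)
    (g : Y ⟶ Z) : Prop :=
  ∀ ⦃P : D⦄ (p : P ⟶ X) (q : P ⟶ Y), IsPullback p q f g →
    IsPullback (H.map p) (H.map q) (H.map f) (H.map g)

namespace CategoryTheory.Functor.PreservesFiberedProduct

variable {H : D ⥤ E} {X Y Z : D} {f : X ⟶ Z} {g : Y ⟶ Z}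

theorem of_isPullback {P : D} {p : P ⟶ X} {q : P ⟶ Y} (h : IsPullback p q f g)
    (h' : IsPullback (H.map p) (H.map q) (H.map f) (H.map g)) :
    H.PreservesFiberedProduct f g := by
  intro P' p' q' hP'
  refine h'.of_iso (H.mapIso (h.isoIsPullback _ _ hP')) (Iso.refl _) (Iso.refl _) (Iso.refl _)
    ?_ ?_ ?_ ?_
  · simp [← H.map_comp]
  · simp [← H.map_comp]
  · simp
  · simp

theorem symm (h : H.PreservesFiberedProduct f g) : H.PreservesFiberedProduct g f :=
  fun _ p q hP => (h q p hP.flip).flip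

theorem iso_comp (h : H.PreservesFiberedProduct f g) {X' : D} (e : X' ≅ X) :
    H.PreservesFiberedProduct (e.hom ≫ f) g := by
  intro P p q hP
  have h1 : IsPullback (p ≫ e.hom) q f g :=
    hP.of_iso (Iso.refl _) e (Iso.refl _) (Iso.refl _) (by simp) (by simp) (by simp) (by simp)
  refine (h _ _ h1).of_iso (Iso.refl _) (H.mapIso e.symm) (Iso.refl _) (Iso.refl _) ?_ ?_ ?_ ?_
  · simp
  · simp
  · simp
  · simp

/-- Pasting of pullback squares. -/
theorem comp (h : H.PreservesFiberedProduct f g) {R : D} {r : R ⟶ X} {s : R ⟶ Y}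
    (hR : IsPullback r s f g) {X' : D} {t : X' ⟶ X} (h' : H.PreservesFiberedProduct t r)
    (hP : ∃ (P : D) (p : P ⟶ X') (q : P ⟶ R), IsPullback p q t r) :
    H.PreservesFiberedProduct (t ≫ f) g := by
  obtain ⟨P, p, q, hP⟩ := hP
  refine of_isPullback (hP.paste_vert hR) ?_
  rw [H.map_comp, H.map_comp]
  exact (h' _ _ hP).paste_vert (h _ _ hR)

theorem of_cover {L : CatTopology E} (hL : L.IsTopology) (hi : CatTopology.IsIntrinsic.{u} L)
    {P : D} {p : P ⟶ X} {q : P ⟶ Y} (hP : IsPullback p q f g) {J : Type u} {X' : J → D}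
    {s : ∀ j, X' j ⟶ X}
    (hs : Presieve.ofArrows (fun j => H.obj (X' j)) (fun j => H.map (s j)) ∈ L.Cov (H.obj X))
    (hP' : ∀ j, ∃ (P' : D) (p' : P' ⟶ X' j) (r : P' ⟶ P), IsPullback p' r (s j) p)
    (h₁ : ∀ j, H.PreservesFiberedProduct (s j) p)
    (h₂ : ∀ j, H.PreservesFiberedProduct (s j ≫ f) g) : H.PreservesFiberedProduct f g := by
  choose P' p' r hP' using hP'
  refine of_isPullback hP (hi.isPullback_of_cover hL (by rw [← H.map_comp, hP.w, H.map_comp]) hs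
    (fun j => h₁ j _ _ (hP' j)) fun j => ?_)
  rw [← H.map_comp, ← H.map_comp]
  exact h₂ j _ _ ((hP' j).paste_vert hP)

end CategoryTheory.Functor.PreservesFiberedProduct

end

/-! ### Continuity of the extended functor -/

namespace Gen

namespace IsBasis

section

variable {C : Type w₁} [Category.{v₁} C] {D : Type w₂} [Category.{v₂} D] {F : C ⥤ D}
  {I : D ⥤ Gen.{u}}

theorem cov_iff {X : C} (S : Presieve X) :
    S ∈ (pseudogeometric ((F ⋙ I) ⋙ Gen.toTop)).Cov X ↔
      Presieve.map F S ∈ (pseudogeometric (I ⋙ Gen.toTop)).Cov (F.obj X) := by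
  constructor
  · rintro ⟨⟨Y, s, hs⟩, h2, h3⟩
    refine ⟨⟨_, _, ⟨hs⟩⟩, ?_, fun x => ?_⟩
    · rintro _ _ ⟨hs⟩
      exact h2 _ hs
    · obtain ⟨Y, s, hs, hx⟩ := h3 x
      exact ⟨_, _, ⟨hs⟩, hx⟩
  · rintro ⟨⟨_, _, ⟨hs⟩⟩, h2, h3⟩
    refine ⟨⟨_, _, hs⟩, fun Y s hs => h2 _ ⟨hs⟩, fun x => ?_⟩
    obtain ⟨_, _, ⟨hs⟩, hx⟩ := h3 x
    exact ⟨_, _, hs, hx⟩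

theorem continuous (h : IsBasis F I) :
    IsContinuousFunctor (pseudogeometric ((F ⋙ I) ⋙ Gen.toTop))
      (pseudogeometric (I ⋙ Gen.toTop)) F where
  map_sub X Y f hf := hf
  map_cov _ S hS := (cov_iff S).1 hS
  map_pullback P U X Y p q f b hb hP := by
    obtain ⟨h1, h2⟩ := h.source.opens_range_of_isPullback hb hP
    exact h.target.isPullback_of hb (by rw [← F.map_comp, hP.w, F.map_comp]) h1 h2

variable {E : Type w} [Category.{v} E] {L : CatTopology E} {H : D ⥤ E}

variable (F I L H) in
/-- The functor `H` takes atlases to affinizations. -/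
def AffinizesAtlases : Prop :=
  ∀ X : D, ∃ (J : Type u) (A : CanopyGraph C J) (θ : ∀ j, F.obj (A.obj j) ⟶ X),
    IsAtlas F I A θ ∧ (A.map (F ⋙ H)).IsAffinization L (fun j => H.map (θ j))

/-- Completeness of the atlas enters here: up to isomorphism `u` is itself a chart. -/
theorem map_sub_of_obj (hL : L.IsTopology) (hH : AffinizesAtlases F I L H) {U : C} {X : D}
    {u : F.obj U ⟶ X} (hu : opens I u) : L.Sub (H.map u) := by
  obtain ⟨J, A, θ, hA, hA'⟩ := hH X
  obtain ⟨j, e, rfl⟩ := hA.complete u hu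
  rw [H.map_comp]
  exact hL.sub.comp _ _ (hL.sub.of_isIso _ inferInstance) (hA'.sub j)

theorem preserves_of_map
    (h : IsBasis F I)
    (hG : IsContinuousFunctor (pseudogeometric ((F ⋙ I) ⋙ Gen.toTop)) L (F ⋙ H)) {U V W : C}
    (f : U ⟶ W) {b : V ⟶ W} (hb : opens (F ⋙ I) b) :
    H.PreservesFiberedProduct (F.map f) (F.map b) := by
  obtain ⟨P, p, q, hP⟩ := h.source.isTopology.exists_isPullback f (b := b) hb
  exact .of_isPullback (h.continuous.map_pullback _ _ _ _ hb hP)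
    (hG.map_pullback _ _ _ _ hb hP)

/-- Up to isomorphism both morphisms are charts of one complete atlas, whose overlaps are preserved
by the affinization. -/
theorem preserves_of_opens_obj
    (hH : AffinizesAtlases F I L H) {V W : C} {X : D} {v : F.obj V ⟶ X} {w : F.obj W ⟶ X}
    (hv : opens I v) (hw : opens I w) : H.PreservesFiberedProduct v w := by
  obtain ⟨J, A, θ, hA, hA'⟩ := hH X
  obtain ⟨j, e, rfl⟩ := hA.complete v hv
  obtain ⟨k, e', rfl⟩ := hA.complete w hw
  have h1 : H.PreservesFiberedProduct (θ j) (θ k) :=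
    .of_isPullback (hA.isPullback j k) (hA'.canopyOf j k)
  exact ((h1.iso_comp (F.mapIso e)).symm.iso_comp (F.mapIso e')).symm

/-- Covering `P` by charts leaves only pairs of open embeddings from basis objects. -/
theorem preserves_of_opens
    (h : IsBasis F I)
    (hL : CatTopology.IsLocalStructure.{u} L)
    (hH : AffinizesAtlases F I L H) {W : C} {P X : D} {f : P ⟶ X} (hf : opens I f) {w : F.obj W ⟶ X}
    (hw : opens I w) : H.PreservesFiberedProduct f w := by
  obtain ⟨V, p, q, -, hV⟩ := h.exists_isPullback_obj w hf
  have hq : opens I q := (h.target.opens_range_of_isPullback hw hV.flip).1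
  obtain ⟨J, A, θ, hA, hA'⟩ := hH P
  exact .of_cover hL.topology hL.intrinsic hV.flip hA'.cov
    (fun j => h.target.isTopology.exists_isPullback (θ j) (b := q) hq)
    (fun j => preserves_of_opens_obj hH (hA.opens j) hq)
    (fun j => preserves_of_opens_obj hH (HasOpens.opens_comp (hA.opens j) hf) hw)

theorem preserves_of_obj
    (h : IsBasis F I)
    (hG : IsContinuousFunctor (pseudogeometric ((F ⋙ I) ⋙ Gen.toTop)) L (F ⋙ H))
    (hL : CatTopology.IsLocalStructure.{u} L)
    (hH : AffinizesAtlases F I L H) {U W : C} {Y : D} (f : F.obj U ⟶ Y) {w : F.obj W ⟶ Y}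
    (hw : opens I w) : H.PreservesFiberedProduct f w := by
  obtain ⟨V, p, q, hp, hV⟩ := h.exists_isPullback f hw
  obtain ⟨J, A, θ, hA, hA'⟩ := hH Y
  obtain ⟨V', a, b, ha, hV', hcov⟩ := h.exists_pullback_atlas hA f
  refine .of_cover hL.topology hL.intrinsic hV (hG.ofArrows_mem_cov hcov)
    (fun j => h.target.isTopology.exists_isPullback _ (b := F.map p) hp)
    (fun j => h.preserves_of_map hG (a j) hp) (fun j => ?_)
  -- On the piece `V' j`, `f` factors through the chart `θ j`. The square is thus pasted from one
  -- over `Y` with both sides open and one lying in the basis.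
  rw [(hV' j).w]
  obtain ⟨R, r, s, hr, hR⟩ := h.exists_isPullback (θ j) hw
  exact (preserves_of_opens_obj hH (hA.opens j) hw).comp hR (h.preserves_of_map hG (b j) hr)
    (h.target.isTopology.exists_isPullback _ (b := F.map r) hr)

theorem preserves_of_target
    (h : IsBasis F I)
    (hG : IsContinuousFunctor (pseudogeometric ((F ⋙ I) ⋙ Gen.toTop)) L (F ⋙ H))
    (hL : CatTopology.IsLocalStructure.{u} L)
    (hH : AffinizesAtlases F I L H) {W : C} {X Y : D} (f : X ⟶ Y) {w : F.obj W ⟶ Y}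
    (hw : opens I w) :
    H.PreservesFiberedProduct f w := by
  obtain ⟨P, p, q, hP, hp, -⟩ := h.target.exists_isPullback f hw
  obtain ⟨J, A, θ, hA, hA'⟩ := hH X
  exact .of_cover hL.topology hL.intrinsic hP hA'.cov
    (fun j => h.target.isTopology.exists_isPullback (θ j) (b := p) hp)
    (fun j => (h.preserves_of_opens hL hH hp (hA.opens j)).symm)
    (fun j => h.preserves_of_obj hG hL hH _ hw)

/-- Here the open subspace `U` is covered by charts; in `preserves_of_target` it was the source `X`
of `f`. The two reductions together leave only morphisms between basis objects and charts. -/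
theorem preserves
    (h : IsBasis F I)
    (hG : IsContinuousFunctor (pseudogeometric ((F ⋙ I) ⋙ Gen.toTop)) L (F ⋙ H))
    (hL : CatTopology.IsLocalStructure.{u} L)
    (hH : AffinizesAtlases F I L H) {U X Y : D} (f : X ⟶ Y) {b : U ⟶ Y} (hb : opens I b) :
    H.PreservesFiberedProduct f b := by
  obtain ⟨P, p, q, hP, -⟩ := h.target.exists_isPullback f hb
  obtain ⟨J, A, θ, hA, hA'⟩ := hH U
  refine (Functor.PreservesFiberedProduct.of_cover hL.topology hL.intrinsic hP.flip hA'.cov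
    (fun j => ?_)
    (fun j => (h.preserves_of_target hG hL hH q (hA.opens j)).symm)
    (fun j => (h.preserves_of_target hG hL hH f
      (HasOpens.opens_comp (hA.opens j) hb)).symm)).symm
  obtain ⟨P', p', q', hP', -⟩ := h.target.exists_isPullback q (hA.opens j)
  exact ⟨P', q', p', hP'.flip⟩

/-- CLCS (ii) applies on an atlas of `X`: since `f` is a monomorphism, its pullback along `θ j ≫ f`
is an identity, and `H` preserves this square. -/
theorem map_sub
    (h : IsBasis F I)
    (hG : IsContinuousFunctor (pseudogeometric ((F ⋙ I) ⋙ Gen.toTop)) L (F ⋙ H))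
    (hL : CatTopology.IsLocalStructure.{u} L)
    (hH : AffinizesAtlases F I L H) {X Y : D} (f : X ⟶ Y) (hf : opens I f) : L.Sub (H.map f) := by
  obtain ⟨J, A, θ, hA, hA'⟩ := hH X
  refine hL.clcs.sub_of_local _ _ hA'.cov ?_
  rintro _ _ ⟨j⟩
  have hj : opens I (θ j ≫ f) := HasOpens.opens_comp (hA.opens j) hf
  have := h.target.mono hf
  have hP : IsPullback (θ j) (𝟙 _) f (θ j ≫ f) :=
    ⟨⟨by simp⟩, ⟨PullbackCone.IsLimit.mk _ (fun s => s.snd)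
      (fun s => by rw [← cancel_mono f, Category.assoc, s.condition]) (fun s => by simp)
      (fun s m _ hm => by simpa using hm)⟩⟩
  rw [← H.map_comp]
  exact ⟨map_sub_of_obj hL.topology hH hj, _, _, _,
    h.preserves_of_target hG hL hH f hj _ _ hP, inferInstance⟩

/-- A functor on `D` whose restriction to `C` is continuous and which affinizes atlases is
continuous. -/
theorem continuous_of_isAffinization
    (h : IsBasis F I)
    (hG : IsContinuousFunctor (pseudogeometric ((F ⋙ I) ⋙ Gen.toTop)) L (F ⋙ H))
    (hL : CatTopology.IsLocalStructure.{u} L)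
    (hH : AffinizesAtlases F I L H) :
    IsContinuousFunctor (pseudogeometric (I ⋙ Gen.toTop)) L H where
  map_sub _ _ f hf := h.map_sub hG hL hH f hf
  map_pullback _ _ _ _ p q f _ hb hP := h.preserves hG hL hH f hb p q hP
  map_cov := by
    intro X S hS
    obtain ⟨J, A, θ, hA, hA'⟩ := hH X
    refine hL.flush.mem_cov_of_local hL.topology hA'.cov ?_ ?_
    · rintro _ _ ⟨hs⟩
      exact h.map_sub hG hL hH _ (hS.2.1 _ hs)
    · rintro _ _ ⟨j⟩
      -- The open subspaces of a chart that factor through `S` form a cover within the basis, where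
      -- continuity of the restricted functor is available.
      let S' : Presieve (A.obj j) := fun V a => opens (F ⋙ I) a ∧
        ∃ (W : D) (s : W ⟶ X) (g : F.obj V ⟶ W), S s ∧ g ≫ s = F.map a ≫ θ j
      have hmem : ∀ x : pts (F ⋙ I) (A.obj j), ∃ (V : C) (a : V ⟶ A.obj j), S' a ∧
          x ∈ Set.range (fn (F ⋙ I) a) := by
        intro x
        obtain ⟨W, s, hs, y, hy⟩ := hS.2.2 (fn I (θ j) x)
        have hs' : opens I s := hS.2.1 s hs
        obtain ⟨V, a, q, ha, hV⟩ := h.exists_isPullback_obj (θ j) hs'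
        obtain ⟨z, hz, -⟩ := h.target.exists_pt_of_isPullback hs' hV hy.symm
        exact ⟨V, a, ⟨ha, W, s, q, hs, hV.w.symm⟩, z, hz⟩
      -- Needed separately, since the chart may be the empty space.
      have hne : ∃ (V : C) (a : V ⟶ A.obj j), S' a := by
        obtain ⟨W, s, hs⟩ := hS.1
        obtain ⟨V, a, q, ha, hV⟩ := h.exists_isPullback_obj (θ j) (hS.2.1 s hs)
        exact ⟨V, a, ha, W, s, q, hs, hV.w.symm⟩
      refine ⟨_, hG.map_cov S' ((mem_cov_iff _).2 ⟨hne, fun V a ha => ha.1, hmem⟩), ?_⟩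
      rintro _ _ ⟨ha, W, s, g, hs, hw⟩
      exact ⟨_, _, H.map g, ⟨hs⟩, by rw [← H.map_comp, hw, H.map_comp]; rfl⟩

end

end IsBasis

end Gen

/-! ### Globalization along a basis, and the main theorem -/

theorem Gen.IsBasis.isGlobalization {C : Type w₁} [Category.{v₁} C] {D : Type w₂}
    [Category.{v₂} D] {F : C ⥤ D} {I : D ⥤ Gen.{u}} (h : Gen.IsBasis F I)
    (hD : CatTopology.IsGlobalStructure.{u} (pseudogeometric (I ⋙ Gen.toTop))) :
    IsGlobalization.{u, v, w} (pseudogeometric ((F ⋙ I) ⋙ Gen.toTop))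
      (pseudogeometric (I ⋙ Gen.toTop)) F where
  source := h.source.isLocalStructure
  target := hD
  continuous := h.continuous
  full := h.full
  faithful := h.faithful
  sub_iff _ _ _ := Iff.rfl
  cov_iff _ S := Gen.IsBasis.cov_iff S
  covered := h.covered
  exists_extension E _ L hL G hG := by
    obtain ⟨H, e, hH⟩ := h.exists_extension_isAffinization hG hL
    exact ⟨H, h.continuous_of_isAffinization
      (hG.of_iso e hL.localStructure.topology hL.localStructure.flush h.source.isTopology)
      hL.localStructure hH, ⟨e.symm⟩⟩
  restrict_bijective E _ L hL G₁ G₂ hG₁ _ :=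
    h.restrict_bijective h.continuous hL.localStructure.topology hL.localStructure.intrinsic hG₁ G₂

/-- The Hausdorff spaces are a basis of the locally Hausdorff spaces. -/
theorem HGen.isBasis_inclusion :
    Gen.IsBasis HGen.inclusion.{u} Gen.locallyHausdorff.{u}.ι where
  full := inferInstance
  faithful := inferInstance
  source := Gen.hasOpens_hausdorff
  target := Gen.hasOpens_locallyHausdorff
  covered Y := by
    let J := {V : Set Y.obj.carrier // IsOpen V ∧ T2Space V}
    let U : J → HGen.{u} := fun V => ⟨Y.obj.restrict V.1 V.2.1, V.2.2⟩
    let θ : ∀ V, HGen.inclusion.obj (U V) ⟶ Y := fun V =>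
      Gen.locallyHausdorff.homMk (Y.obj.restrictι V.1 V.2.1)
    -- The empty open subset keeps the cover non-empty even when `Y` is empty.
    refine ⟨J, U, θ, Gen.HasOpens.ofArrows_mem_cov_iff.2
      ⟨⟨∅, isOpen_empty, inferInstance⟩, fun V => V.2.1.isOpenEmbedding_subtypeVal, fun x => ?_⟩⟩
    obtain ⟨𝒱, h1, h2⟩ := Y.property
    obtain ⟨V, hV, hx⟩ := h2.symm.subset (Set.mem_univ x)
    exact ⟨⟨V, h1 V hV⟩, ⟨x, hx⟩, rfl⟩

theorem mainTheorem4 :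
    CatTopology.IsGlobalStructure.{u, u, u + 1} Gen.topology.{u} ∧
    CatTopology.IsGlobalStructure.{u, u, u + 1} HGenPlus.topology.{u} ∧
    CatTopology.IsLocalStructure.{u, u, u + 1} HGen.topology.{u} ∧
    IsGlobalization.{u, v, w, u, u + 1, u, u + 1}
      HGen.topology.{u} HGenPlus.topology.{u} HGen.inclusion.{u} :=
  ⟨Gen.isGlobalStructure_topology, HGenPlus.isGlobalStructure_topology,
    HGen.isLocalStructure_topology,
    HGen.isBasis_inclusion.isGlobalization HGenPlus.isGlobalStructure_topology⟩
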